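/- Let $\mathcal P_6$ be the surface of the cube of edge length $1$, with faces $F_1,\dots,F_6$ such that $F_1$ and $F_6$ are opposite and, seen from outside with $F_1$ in front, $F_2,F_4,F_5,F_3$ follow one another in this counter-clockwise order around $F_1$. *Landscapes.* A net of the cube is obtained by cutting the surface along edges so that it can be laid out flat in one piece; the pairs of faces that stay attached form a spanning tree (the dual graph of the net) of the graph in which two faces are adjacent when they share an edge. A landscape is the part of a net formed by the faces along a path with at least two vertices in the dual graph of the net; we write it as the sequence of these faces, a sequence and its reverse giving the same landscape. A sublandscape of $L$ is a landscape formed by consecutive faces of $L$. For points $p,q$ of the surface lying on faces of $L$, the trail length $|T_L(p,q)|$ is the length of the line segment joining $p$ and $q$ in the laid out landscape $L\subset\mathbb R^2$ if this segment is contained in $L$, and $\infty$ otherwise (if a point on an edge of the cube occurs at several places of the laid out landscape, the smallest value is taken). The surface distance is $d(p,q)=\min\{|T_L(p,q)| : L \text{ a landscape containing } p \text{ and } q\}$. A landscape $L$ is valid if there are points $p,q\in L$ such that $|T_L(p,q)|=d(p,q)$ and such that $L$ does not contain as a sublandscape any other landscape $K$ with $p,q\in K$ and $|T_K(p,q)|=|T_L(p,q)|$.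 *The named landscapes.* A labelling is a permutation $n_1,\dots,n_6$ of $1,\dots,6$ such that $F_{n_1}$ and $F_{n_6}$ are opposite and $F_{n_2},F_{n_3},F_{n_4},F_{n_5}$ occur about $F_{n_1}$ in the same counter-clockwise order as $F_2,F_3,F_4,F_5$ about $F_1$. Writing $abc\dots$ for the landscape $F_{n_a},F_{n_b},F_{n_c},\dots$, put, for a given labelling, $$L_1,\dots,L_{15}:\quad 12,\ 132,\ 142,\ 126,\ 136,\ 146,\ 156,\ 1236,\ 1356,\ 1546,\ 1426,\ 1246,\ 1326,\ 1536,\ 1456,$$ $$L_1^*,\dots,L_5^*:\quad 1264,\ 1263,\ 1265,\ 12465,\ 12365 .$$ **Theorem.** Let $L$ be a landscape of the cube that is not one of $L_1,\dots,L_{15}$ for any labelling. Then $L$ is not valid. Moreover, for every labelling, $L_1^*,\dots,L_5^*$ are landscapes that are not valid, and every landscape of the cube that is not one of $L_1,\dots,L_{15}$ for any labelling contains, for some labelling, one of $L_1^*,\dots,L_5^*$ as a sublandscape. -/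

import Mathlib

open scoped ENNReal RealInnerProductSpace

/-- The six faces of the cube. -/
inductive Face where
  | F1 | F2 | F3 | F4 | F5 | F6
  deriving DecidableEq

instance : Fintype Face where
  elems := {Face.F1, Face.F2, Face.F3, Face.F4, Face.F5, Face.F6}
  complete := fun f => by cases f <;> decide

namespace Cube

open Face

/-- Ambient Euclidean space. -/
abbrev E3 := EuclideanSpace ℝ (Fin 3)

/-- Outer unit normals (integer coordinates). Seen from outside with `F1` in front, the faces
`F2`, `F4`, `F5`, `F3` lie below, to the right, above and to the left of `F1`, and `F6` is
opposite to `F1`. -/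
def normal : Face → Fin 3 → ℤ
  | F1 => ![0, 0, 1]
  | F2 => ![0, -1, 0]
  | F3 => ![-1, 0, 0]
  | F4 => ![1, 0, 0]
  | F5 => ![0, 1, 0]
  | F6 => ![0, 0, -1]

/-- The outer unit normal as a vector of `E3`. -/
noncomputable def normalVec (f : Face) : E3 := WithLp.toLp 2 fun i => (normal f i : ℝ)

/-- The closed square face `f` of the cube `[-1/2, 1/2]³` of edge length `1`. -/
def faceSet (f : Face) : Set E3 :=
  {x | (∀ i, |x i| ≤ 1 / 2) ∧ ⟪normalVec f, x⟫ = 1 / 2}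

/-- The adjacency graph of the faces: two faces share an edge of the cube iff their normals are
orthogonal. -/
def faceGraph : SimpleGraph Face where
  Adj f g := normal f ⬝ᵥ normal g = 0
  symm := ⟨fun f g h => by rw [dotProduct_comm]; exact h⟩
  loopless := ⟨fun f => by cases f <;> decide⟩

/-- The dual graph of a net of the cube. A net arises by cutting the surface along edges so that
it can be laid out flat in one connected piece; the pairs of faces which stay attached to each
other form a spanning tree of the face graph. (For the cube every spanning tree gives a layout
without overlaps, in which only attached faces share a side.) -/
def IsNetDual (T : SimpleGraph Face) : Prop := T ≤ faceGraph ∧ T.IsTree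

/-- A landscape, listed from its origin face to its destination face: the faces along a path with
at least two vertices in the dual graph of some net. A list and its reverse describe the same
landscape, read in the two directions. -/
def IsLandscape (L : List Face) : Prop :=
  2 ≤ L.length ∧ L.Nodup ∧ ∃ T : SimpleGraph Face, IsNetDual T ∧ L.IsChain T.Adj

/-- `K` is a sublandscape of `L`: it is a subpath of `L` (in either direction). -/
def IsSublandscape (K L : List Face) : Prop := K <:+: L ∨ K.reverse <:+: L

/-- The rotation by a right angle about the common edge of the adjacent faces `f` and `g` which
carries the face `g` into the plane of `f`, onto the square on the other side of that edge. -/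
noncomputable def unroll (f g : Face) (x : E3) : E3 :=
  let a := ⟪normalVec f, x⟫ - 1 / 2
  let b := ⟪normalVec g, x⟫ - 1 / 2
  x + (b - a) • normalVec f - (a + b) • normalVec g

/-- `develop L h` lays the face `h` of the landscape `L` out in the plane of the first face of
`L` (a copy of `ℝ²`), by unrolling successively about the edges common to consecutive faces. -/
noncomputable def develop : List Face → Face → E3 → E3
  | f :: g :: L, h, x => if h = f then x else unroll f g (develop (g :: L) h x)
  | _, _, x => x

/-- The landscape as a region of the plane: the union of its laid out faces. -/
def region (L : List Face) : Set E3 := ⋃ h ∈ L, develop L h '' faceSet h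

/-- The points of the surface of the cube which belong to the landscape. -/
def points (L : List Face) : Set E3 := ⋃ h ∈ L, faceSet h

/-- The positions in the laid out landscape of the point `p` of the surface. (A point on an edge
of the cube can have several.) -/
def positions (L : List Face) (p : E3) : Set E3 :=
  {x | ∃ h ∈ L, p ∈ faceSet h ∧ x = develop L h p}

/-- The length of the trail from `p` to `q` in the landscape `L`: the length of the line segment
joining (positions of) the two points in the laid out landscape, provided that the segment is
contained in it; `∞` if there is no such segment. -/
noncomputable def trailLength (L : List Face) (p q : E3) : ℝ≥0∞ :=
  ⨅ x ∈ positions L p, ⨅ y ∈ positions L q, ⨅ _ : segment ℝ x y ⊆ region L, edist x y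

/-- The surface distance: the minimum of the trail lengths over all landscapes. -/
noncomputable def surfaceDist (p q : E3) : ℝ≥0∞ :=
  ⨅ (L : List Face) (_ : IsLandscape L), trailLength L p q

/-- Validity of a landscape. -/
def IsValid (L : List Face) : Prop :=
  ∃ p ∈ points L, ∃ q ∈ points L,
    trailLength L p q = surfaceDist p q ∧
    ∀ K : List Face, IsLandscape K → K ≠ L → K ≠ L.reverse → p ∈ points K → q ∈ points K →
      trailLength L p q = trailLength K p q → ¬ IsSublandscape K L

open scoped Matrix in
/-- The admissible labellings `n₁, …, n₆` of the faces: `n₁` and `n₆` are opposite, and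
`n₂, n₃, n₄, n₅` occur about `n₁` in the same counter-clockwise order as `F2, F3, F4, F5` occur
about `F1`. (Seen from outside, the face following `g` counter-clockwise about `f` is the one
whose normal is the cross product of the normals of `f` and `g`.) -/
def IsLabelling (n : Equiv.Perm Face) : Prop :=
  normal (n F6) = -normal (n F1) ∧
  normal (n F1) ⨯₃ normal (n F2) = normal (n F4) ∧
  normal (n F1) ⨯₃ normal (n F4) = normal (n F5) ∧
  normal (n F1) ⨯₃ normal (n F5) = normal (n F3) ∧
  normal (n F1) ⨯₃ normal (n F3) = normal (n F2)

/-- The fifteen landscapes `L₁, …, L₁₅` for a labelling `n`. -/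
def fifteen (n : Equiv.Perm Face) : Fin 15 → List Face :=
  ![[n F1, n F2],
    [n F1, n F3, n F2],
    [n F1, n F4, n F2],
    [n F1, n F2, n F6],
    [n F1, n F3, n F6],
    [n F1, n F4, n F6],
    [n F1, n F5, n F6],
    [n F1, n F2, n F3, n F6],
    [n F1, n F3, n F5, n F6],
    [n F1, n F5, n F4, n F6],
    [n F1, n F4, n F2, n F6],
    [n F1, n F2, n F4, n F6],
    [n F1, n F3, n F2, n F6],
    [n F1, n F5, n F3, n F6],
    [n F1, n F4, n F5, n F6]]

/-- The five landscapes `L₁*, …, L₅*` for a labelling `n`. -/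
def starred (n : Equiv.Perm Face) : Fin 5 → List Face :=
  ![[n F1, n F2, n F6, n F4],
    [n F1, n F2, n F6, n F3],
    [n F1, n F2, n F6, n F5],
    [n F1, n F2, n F4, n F6, n F5],
    [n F1, n F2, n F3, n F6, n F5]]

/-- `L` is one of the fifteen landscapes, for some admissible labelling of the faces. -/
def IsAmongFifteen (L : List Face) : Prop :=
  ∃ n : Equiv.Perm Face, IsLabelling n ∧ ∃ i, L = fifteen n i

end Cube

open scoped ENNReal RealInnerProductSpace

namespace Cube

open Face

set_option linter.unusedSimpArgs false

/-! Up to symmetry a landscape is determined by very little. Write `f, g, h` for three faces meeting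
at a vertex and `F, G, H` for their opposites. A simple path in the face graph (the graph of the
octahedron) that starts `f, g` is, after possibly exchanging `h` and `H`, one of eighteen words in
these letters. Four of them (`fg`, `fgF`, `fgh`, `fghF`) are exactly the shapes of the fifteen named
landscapes; the other fourteen are long, and each contains a starred landscape, possibly reversed.

Invalidity rests on one comparison. Let `p` and `q` lie on the end faces of a path, and let `r` be
the planar distance between their laid out positions, whether or not the segment stays inside the
layout. Then either the surface distance is strictly below `r`, or some short subpath containing
both points has a trail of length at most `r` (`Shortenable`). For a short path whose segment leaves
the layout, the segment passes a cube vertex on the wrong side. The total angle there is only three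
right angles, so turning the rest of the layout by a right angle about that vertex brings the points
strictly closer. For a long path, an explicit competing short path is strictly shorter unless an end
point lies on the edge towards its neighbouring face, and then the end face can be dropped.

In every comparison the squares of the in-face coordinates of `p` and `q` cancel, so the difference
of the two squared distances is affine in each point separately. It is bounded by products of the
nonnegative slacks in the inequalities defining the faces.

The comparison then passes to arbitrary positions in a landscape by cutting off unused faces
(`IsLandscape.shortenable`). If a landscape is not among the fifteen, the first alternative
contradicts that its trail realises the surface distance, and the second contradicts its minimality
(`IsLandscape.not_isValid`). -/

/-! ### Opposite faces and frames -/

instance : DecidableRel faceGraph.Adj := fun f g =>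
  inferInstanceAs (Decidable (normal f ⬝ᵥ normal g = 0))

/-- The face opposite to a given face. -/
def opp : Face → Face
  | F1 => F6
  | F2 => F5
  | F3 => F4
  | F4 => F3
  | F5 => F2
  | F6 => F1

@[simp] theorem opp_opp (f : Face) : opp (opp f) = f := by cases f <;> rfl

theorem normal_opp (f : Face) : normal (opp f) = -normal f := by revert f; decide

theorem normal_injective : Function.Injective normal := by
  intro f g; revert f g; decide

/-- Three faces meeting at a vertex of the cube. -/
structure Frame (f g h : Face) : Prop where
  fg : faceGraph.Adj f g
  gh : faceGraph.Adj g h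
  fh : faceGraph.Adj f h

theorem adj_opp_left {f g : Face} : faceGraph.Adj (opp f) g ↔ faceGraph.Adj f g := by
  revert f g; decide

theorem adj_opp_right {f g : Face} : faceGraph.Adj f (opp g) ↔ faceGraph.Adj f g := by
  revert f g; decide

theorem ne_opp (f : Face) : f ≠ opp f := by revert f; decide

theorem not_adj_opp (f : Face) : ¬ faceGraph.Adj f (opp f) := by revert f; decide

theorem exists_frame {f g : Face} (h : faceGraph.Adj f g) : ∃ k, Frame f g k := by
  have : ∀ f g, faceGraph.Adj f g → ∃ k, faceGraph.Adj g k ∧ faceGraph.Adj f k := by decide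
  obtain ⟨k, h1, h2⟩ := this f g h
  exact ⟨k, h, h1, h2⟩

namespace Frame

variable {f g h : Face}

theorem rotate (H : Frame f g h) : Frame g h f := ⟨H.gh, H.fh.symm, H.fg.symm⟩

theorem swap (H : Frame f g h) : Frame g f h := ⟨H.fg.symm, H.fh, H.gh⟩

theorem opp_left (H : Frame f g h) : Frame (opp f) g h :=
  ⟨adj_opp_left.2 H.fg, H.gh, adj_opp_left.2 H.fh⟩

theorem eq_or (H : Frame f g h) (k : Face) :
    k = f ∨ k = opp f ∨ k = g ∨ k = opp g ∨ k = h ∨ k = opp h := by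
  have : ∀ f g h k, faceGraph.Adj f g → faceGraph.Adj g h → faceGraph.Adj f h →
      k = f ∨ k = opp f ∨ k = g ∨ k = opp g ∨ k = h ∨ k = opp h := by decide
  exact this f g h k H.fg H.gh H.fh

end Frame

/-! ### Coordinates adapted to a frame; unrolling as an isometry -/

/-- The coordinate of a point in the direction of the outer normal of a face. -/
noncomputable def co (f : Face) (x : E3) : ℝ := ⟪normalVec f, x⟫

theorem co_eq (f : Face) (x : E3) :
    co f x = normal f 0 * x 0 + normal f 1 * x 1 + normal f 2 * x 2 := by
  simp [co, normalVec, PiLp.inner_apply, Fin.sum_univ_three, mul_comm]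

theorem co_opp (f : Face) (x : E3) : co (opp f) x = -co f x := by
  simp only [co_eq, normal_opp, Pi.neg_apply, Int.cast_neg]; ring

theorem co_add (f : Face) (x y : E3) : co f (x + y) = co f x + co f y := inner_add_right _ _ _

theorem co_sub (f : Face) (x y : E3) : co f (x - y) = co f x - co f y := inner_sub_right _ _ _

theorem co_smul (f : Face) (c : ℝ) (x : E3) : co f (c • x) = c * co f x :=
  real_inner_smul_right _ _ _

theorem co_normalVec (f g : Face) : co f (normalVec g) = ((normal f ⬝ᵥ normal g : ℤ) : ℝ) := by
  simp [co_eq, normalVec, dotProduct, Fin.sum_univ_three]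

theorem co_normalVec_self (f : Face) : co f (normalVec f) = 1 := by
  have : ∀ f, normal f ⬝ᵥ normal f = 1 := by decide
  rw [co_normalVec, this, Int.cast_one]

theorem co_normalVec_of_adj {f g : Face} (h : faceGraph.Adj f g) : co f (normalVec g) = 0 := by
  rw [co_normalVec, show normal f ⬝ᵥ normal g = 0 from h, Int.cast_zero]

theorem unroll_eq (f g : Face) (x : E3) : unroll f g x =
    x + (co g x - co f x) • normalVec f - (co f x + co g x - 1) • normalVec g := by
  simp only [unroll, co]
  module

theorem co_unroll_left {f g : Face} (h : faceGraph.Adj f g) (x : E3) :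
    co f (unroll f g x) = co g x := by
  rw [unroll_eq, co_sub, co_add, co_smul, co_smul, co_normalVec_self, co_normalVec_of_adj h]
  ring

theorem co_unroll_right {f g : Face} (h : faceGraph.Adj f g) (x : E3) :
    co g (unroll f g x) = 1 - co f x := by
  rw [unroll_eq, co_sub, co_add, co_smul, co_smul, co_normalVec_self, co_normalVec_of_adj h.symm]
  ring

theorem co_unroll_of_adj {f g h : Face} (hf : faceGraph.Adj h f) (hg : faceGraph.Adj h g) (x : E3) :
    co h (unroll f g x) = co h x := by
  rw [unroll_eq, co_sub, co_add, co_smul, co_smul, co_normalVec_of_adj hf, co_normalVec_of_adj hg]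
  ring

theorem norm_sq_eq {f g h : Face} (H : Frame f g h) (x : E3) :
    ‖x‖ ^ 2 = co f x ^ 2 + co g x ^ 2 + co h x ^ 2 := by
  -- The three normals are the rows of an orthogonal integer matrix; the sum over rows used here
  -- says that its columns are orthonormal.
  have key : ∀ f g h, faceGraph.Adj f g → faceGraph.Adj g h → faceGraph.Adj f h →
      ∀ i j : Fin 3, normal f i * normal f j + normal g i * normal g j + normal h i * normal h j
        = if i = j then 1 else 0 := by decide
  have key' : ∀ i j : Fin 3, (normal f i * normal f j + normal g i * normal g j +
      normal h i * normal h j : ℝ) = if i = j then 1 else 0 := fun i j => by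
    exact_mod_cast key f g h H.fg H.gh H.fh i j
  rw [EuclideanSpace.real_norm_sq_eq, Fin.sum_univ_three]
  simp only [co_eq]
  have h00 := key' 0 0
  have h11 := key' 1 1
  have h22 := key' 2 2
  have h01 := key' 0 1
  have h02 := key' 0 2
  have h12 := key' 1 2
  simp at h00 h11 h22 h01 h02 h12
  linear_combination (-x 0 ^ 2) * h00 - x 1 ^ 2 * h11 - x 2 ^ 2 * h22 - 2 * x 0 * x 1 * h01
    - 2 * x 0 * x 2 * h02 - 2 * x 1 * x 2 * h12

theorem dist_sq_eq {f g h : Face} (H : Frame f g h) (x y : E3) :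
    dist x y ^ 2 = (co f x - co f y) ^ 2 + (co g x - co g y) ^ 2 + (co h x - co h y) ^ 2 := by
  rw [dist_eq_norm, norm_sq_eq H]
  simp only [co_sub]

theorem ext_co {f g h : Face} (H : Frame f g h) {x y : E3} (hf : co f x = co f y)
    (hg : co g x = co g y) (hh : co h x = co h y) : x = y := by
  have := dist_sq_eq H x y
  rw [hf, hg, hh] at this
  simpa using this

theorem edist_le_of_sq {x y x' y' : E3} (h : dist x y ^ 2 ≤ dist x' y' ^ 2) :
    edist x y ≤ edist x' y' := by
  rw [edist_dist, edist_dist]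
  exact ENNReal.ofReal_le_ofReal (abs_le_of_sq_le_sq' h dist_nonneg).2

theorem edist_lt_of_sq {x y x' y' : E3} (h : dist x y ^ 2 < dist x' y' ^ 2) :
    edist x y < edist x' y' := by
  have h' := (abs_lt_of_sq_lt_sq' h dist_nonneg).2
  rw [edist_dist, edist_dist]
  exact (ENNReal.ofReal_lt_ofReal_iff (dist_nonneg.trans_lt h')).2 h'

theorem edist_unroll {f g : Face} (h : faceGraph.Adj f g) (x y : E3) :
    edist (unroll f g x) (unroll f g y) = edist x y := by
  obtain ⟨k, H⟩ := exists_frame h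
  have : dist (unroll f g x) (unroll f g y) ^ 2 = dist x y ^ 2 := by
    simp only [dist_sq_eq H, co_unroll_left h, co_unroll_right h,
      co_unroll_of_adj H.fh.symm H.gh.symm]
    ring
  exact le_antisymm (edist_le_of_sq this.le) (edist_le_of_sq this.ge)

theorem unroll_unroll {f g : Face} (h : faceGraph.Adj f g) (x : E3) :
    unroll f g (unroll g f x) = x := by
  obtain ⟨k, H⟩ := exists_frame h
  refine ext_co H ?_ ?_ ?_
  · rw [co_unroll_left h, co_unroll_left h.symm]
  · rw [co_unroll_right h, co_unroll_right h.symm]; ring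
  · rw [co_unroll_of_adj H.fh.symm H.gh.symm, co_unroll_of_adj H.gh.symm H.fh.symm]

theorem mem_faceSet_iff {f g h : Face} (H : Frame f g h) {x : E3} :
    x ∈ faceSet f ↔ co f x = 1 / 2 ∧ (-(1 / 2) ≤ co g x ∧ co g x ≤ 1 / 2) ∧
      (-(1 / 2) ≤ co h x ∧ co h x ≤ 1 / 2) := by
  -- The cube as an intersection of six half spaces, a description that does not depend on the
  -- choice of frame.
  have hall : x ∈ faceSet f ↔ co f x = 1 / 2 ∧ ∀ k, co k x ≤ 1 / 2 := by
    have e1 : co F1 x = x 2 := by simp [co_eq, normal]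
    have e2 : co F2 x = -x 1 := by simp [co_eq, normal]
    have e3 : co F3 x = -x 0 := by simp [co_eq, normal]
    have e4 : co F4 x = x 0 := by simp [co_eq, normal]
    have e5 : co F5 x = x 1 := by simp [co_eq, normal]
    have e6 : co F6 x = -x 2 := by simp [co_eq, normal]
    constructor
    · rintro ⟨h1, h2⟩
      refine ⟨h2, fun k => ?_⟩
      have h0 := abs_le.1 (h1 0)
      have h1' := abs_le.1 (h1 1)
      have h2' := abs_le.1 (h1 2)
      cases k <;> simp only [e1, e2, e3, e4, e5, e6] <;> linarith
    · rintro ⟨h1, h2⟩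
      refine ⟨fun i => abs_le.2 ?_, h1⟩
      have i1 := h2 F1
      have i2 := h2 F2
      have i3 := h2 F3
      have i4 := h2 F4
      have i5 := h2 F5
      have i6 := h2 F6
      rw [e1] at i1; rw [e2] at i2; rw [e3] at i3; rw [e4] at i4; rw [e5] at i5; rw [e6] at i6
      fin_cases i <;> constructor <;> simp <;> linarith
  rw [hall]
  constructor
  · rintro ⟨h1, h2⟩
    have a := h2 g
    have b := h2 (opp g)
    have c := h2 h
    have d := h2 (opp h)
    rw [co_opp] at b d
    refine ⟨h1, ⟨?_, ?_⟩, ?_, ?_⟩ <;> linarith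
  · rintro ⟨h1, ⟨h2, h3⟩, h4, h5⟩
    refine ⟨h1, fun k => ?_⟩
    rcases H.eq_or k with rfl | rfl | rfl | rfl | rfl | rfl <;> (try rw [co_opp]) <;> linarith

/-! ### Landscapes are the simple paths of the face graph -/

/-- The graph whose edges join consecutive elements of a list. -/
def listGraph : List Face → SimpleGraph Face
  | f :: g :: L => listGraph (g :: L) ⊔ SimpleGraph.edge f g
  | _ => ⊥

theorem mem_of_listGraph_adj : ∀ {L : List Face} {x y : Face}, (listGraph L).Adj x y → x ∈ L
  | f :: g :: L, x, y, h => by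
    rw [listGraph, SimpleGraph.sup_adj, SimpleGraph.edge_adj] at h
    rcases h with h | h
    · exact List.mem_cons_of_mem _ (mem_of_listGraph_adj h)
    · rcases h.1 with h | h <;> simp [h.1]
  | [], _, _, h => h.elim
  | [_], _, _, h => h.elim

theorem isAcyclic_listGraph : ∀ {L : List Face}, L.Nodup → (listGraph L).IsAcyclic
  | f :: g :: L, h => by
    rw [List.nodup_cons] at h
    refine SimpleGraph.IsAcyclic.sup_edge_of_not_reachable ?_ (isAcyclic_listGraph h.2)
    rintro ⟨w⟩
    cases w with
    | nil => exact h.1 List.mem_cons_self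
    | cons hadj _ => exact h.1 (mem_of_listGraph_adj hadj)
  | [], _ => SimpleGraph.isAcyclic_bot
  | [_], _ => SimpleGraph.isAcyclic_bot

theorem listGraph_le : ∀ {L : List Face}, L.IsChain faceGraph.Adj → listGraph L ≤ faceGraph
  | f :: g :: L, h => by
    rw [List.isChain_cons_cons] at h
    refine sup_le (listGraph_le h.2) ?_
    rw [SimpleGraph.edge_le_iff]
    exact Or.inr h.1
  | [], _ => bot_le
  | [_], _ => bot_le

theorem isChain_listGraph : ∀ {L : List Face}, L.Nodup → L.IsChain (listGraph L).Adj
  | f :: g :: L, h => by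
    rw [List.nodup_cons] at h
    rw [List.isChain_cons_cons]
    refine ⟨Or.inr ?_, (isChain_listGraph h.2).imp fun _ _ => Or.inl⟩
    rw [SimpleGraph.edge_adj]
    exact ⟨Or.inl ⟨rfl, rfl⟩, fun e => h.1 (e ▸ List.mem_cons_self)⟩
  | [], _ => List.isChain_nil
  | [_], _ => List.isChain_singleton _

theorem faceGraph_connected : faceGraph.Connected := by
  have : ∀ f g, ∃ k, (f = k ∨ faceGraph.Adj f k) ∧ (k = g ∨ faceGraph.Adj k g) := by decide
  have : Nonempty Face := ⟨F1⟩
  refine ⟨fun f g => ?_⟩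
  obtain ⟨k, h1, h2⟩ := ‹∀ f g, ∃ k, _› f g
  refine SimpleGraph.Reachable.trans (v := k) ?_ ?_
  · rcases h1 with rfl | h
    exacts [.rfl, h.reachable]
  · rcases h2 with rfl | h
    exacts [.rfl, h.reachable]

/-- Every simple path in the face graph is a landscape. -/
theorem isLandscape_iff {L : List Face} :
    IsLandscape L ↔ 2 ≤ L.length ∧ L.Nodup ∧ L.IsChain faceGraph.Adj := by
  constructor
  · rintro ⟨h1, h2, T, hT, h3⟩
    exact ⟨h1, h2, h3.imp fun _ _ h => hT.1 h⟩
  · rintro ⟨h1, h2, h3⟩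
    -- The edges of a simple path form an acyclic subgraph, and any such subgraph of a connected
    -- graph extends to a spanning tree.
    obtain ⟨T, hT1, hT2, hT3⟩ := faceGraph_connected.exists_isTree_le_of_le_of_isAcyclic
      (listGraph_le h3) (isAcyclic_listGraph h2)
    exact ⟨h1, h2, T, ⟨hT2, hT3⟩, (isChain_listGraph h2).imp fun _ _ h => hT1 h⟩

/-! ### Classification of simple paths up to symmetry -/

/-- The shapes of the landscapes `L₁, …, L₁₅`. -/
inductive ShortPath : List Face → Prop
  | edge {f g h} (H : Frame f g h) : ShortPath [f, g]
  | straight {f g h} (H : Frame f g h) : ShortPath [f, g, opp f]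
  | bend {f g h} (H : Frame f g h) : ShortPath [f, g, h]
  | zigzag {f g h} (H : Frame f g h) : ShortPath [f, g, h, opp f]

/-- The shapes of the remaining landscapes. -/
inductive LongPath : List Face → Prop
  | fgFG {f g h} (H : Frame f g h) : LongPath [f, g, opp f, opp g]
  | fgFh {f g h} (H : Frame f g h) : LongPath [f, g, opp f, h]
  | fghG {f g h} (H : Frame f g h) : LongPath [f, g, h, opp g]
  | fgFGh {f g h} (H : Frame f g h) : LongPath [f, g, opp f, opp g, h]
  | fgFhG {f g h} (H : Frame f g h) : LongPath [f, g, opp f, h, opp g]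
  | fghGF {f g h} (H : Frame f g h) : LongPath [f, g, h, opp g, opp f]
  | fghGH {f g h} (H : Frame f g h) : LongPath [f, g, h, opp g, opp h]
  | fghFG {f g h} (H : Frame f g h) : LongPath [f, g, h, opp f, opp g]
  | fghFH {f g h} (H : Frame f g h) : LongPath [f, g, h, opp f, opp h]
  | fgFhGH {f g h} (H : Frame f g h) : LongPath [f, g, opp f, h, opp g, opp h]
  | fghGFH {f g h} (H : Frame f g h) : LongPath [f, g, h, opp g, opp f, opp h]
  | fghGHF {f g h} (H : Frame f g h) : LongPath [f, g, h, opp g, opp h, opp f]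
  | fghFGH {f g h} (H : Frame f g h) : LongPath [f, g, h, opp f, opp g, opp h]
  | fghFHG {f g h} (H : Frame f g h) : LongPath [f, g, h, opp f, opp h, opp g]

theorem Frame.opp_right {f g h : Face} (H : Frame f g h) : Frame f g (opp h) :=
  H.rotate.rotate.opp_left.rotate

/-- The new face is one of the six faces of the frame. Where the third direction has not yet been
used, `opp h` may be renamed `h`, which is why `H.opp_right` appears. -/
theorem ShortPath.concat {L : List Face} {m : Face} (hL : ShortPath L) (hn : (L ++ [m]).Nodup)
    (hc : (L ++ [m]).IsChain faceGraph.Adj) : ShortPath (L ++ [m]) ∨ LongPath (L ++ [m]) := by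
  cases hL
  all_goals
    rename_i H
    simp only [List.cons_append, List.nil_append, List.isChain_cons_cons, List.isChain_singleton,
      and_true, List.nodup_cons, List.mem_cons, not_or] at hn hc ⊢
    rcases H.eq_or m with rfl | rfl | rfl | rfl | rfl | rfl
  all_goals first
    | (left; constructor; assumption)
    | (left; constructor; exact H.opp_right)
    | (right; constructor; assumption)
    | (right; constructor; exact H.opp_right)
    | (exfalso; simp_all [not_adj_opp])

set_option maxHeartbeats 1000000 in
theorem LongPath.concat {L : List Face} {m : Face} (hL : LongPath L) (hn : (L ++ [m]).Nodup)
    (hc : (L ++ [m]).IsChain faceGraph.Adj) : LongPath (L ++ [m]) := by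
  cases hL
  all_goals
    rename_i H
    simp only [List.cons_append, List.nil_append, List.isChain_cons_cons, List.isChain_singleton,
      and_true, List.nodup_cons, List.mem_cons, not_or] at hn hc ⊢
    rcases H.eq_or m with rfl | rfl | rfl | rfl | rfl | rfl
  all_goals first
    | (exfalso; simp [not_adj_opp, adj_opp_left] at hn hc; done)
    | (constructor; assumption)
    | (constructor; exact H.opp_right)

theorem shortPath_or_longPath {L : List Face} (h2 : 2 ≤ L.length) (hn : L.Nodup)
    (hc : L.IsChain faceGraph.Adj) : ShortPath L ∨ LongPath L := by
  induction L using List.reverseRecOn with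
  | nil => simp at h2
  | append_singleton L m ih =>
    match L, ih with
    | [], _ => simp at h2
    | [f], _ =>
      obtain ⟨h, H⟩ := exists_frame (by simpa using hc)
      exact Or.inl (.edge H)
    | f :: g :: L, ih =>
      rcases ih (by simp) hn.of_append_left hc.left_of_append with h | h
      exacts [h.concat hn hc, Or.inr (h.concat hn hc)]

/-! ### Labellings and the named landscapes -/

/-- The labelling candidate determined by the images of `F1`, `F2` and `F4`. -/
def labelFun (f g h : Face) : Face → Face
  | F1 => f
  | F2 => g
  | F3 => opp h
  | F4 => h
  | F5 => opp g
  | F6 => opp f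

theorem Frame.labelFun_injective {f g h : Face} (H : Frame f g h) :
    Function.Injective (labelFun f g h) := by
  have : ∀ f g h, faceGraph.Adj f g → faceGraph.Adj g h → faceGraph.Adj f h →
      ∀ x y, labelFun f g h x = labelFun f g h y → x = y := by decide
  exact fun x y => this f g h H.fg H.gh H.fh x y

open scoped Matrix in
theorem Frame.cross_eq {f g h : Face} (H : Frame f g h) :
    normal f ⨯₃ normal g = normal h ∨ normal f ⨯₃ normal g = normal (opp h) := by
  have : ∀ f g h, faceGraph.Adj f g → faceGraph.Adj g h → faceGraph.Adj f h →
    normal f ⨯₃ normal g = normal h ∨ normal f ⨯₃ normal g = normal (opp h) := by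
    simp only [cross_apply]
    decide
  exact this f g h H.fg H.gh H.fh

open scoped Matrix in
theorem Frame.isLabelling_labelFun {f g h : Face} (H : Frame f g h)
    (hc : normal f ⨯₃ normal g = normal h) :
    ∃ n : Equiv.Perm Face, IsLabelling n ∧ ⇑n = labelFun f g h := by
  have hb := Finite.injective_iff_bijective.1 H.labelFun_injective
  refine ⟨Equiv.ofBijective _ hb, ?_, rfl⟩
  have : ∀ f g h, faceGraph.Adj f g → normal f ⨯₃ normal g = normal h →
      normal f ⨯₃ normal h = normal (opp g) := by
    simp only [cross_apply]
    decide
  have h2 := this f g h H.fg hc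
  refine ⟨normal_opp f, hc, h2, ?_, ?_⟩
  · change normal f ⨯₃ normal (opp g) = normal (opp h)
    rw [normal_opp, normal_opp, map_neg, hc]
  · change normal f ⨯₃ normal (opp h) = normal g
    rw [normal_opp, map_neg, h2, normal_opp, neg_neg]

/-- A frame carries no orientation while a labelling does: a positively oriented frame puts `h` in
the place of `F4`, a negatively oriented one in the place of `F3`. The named landscapes come in
mirror images, so either outcome is usable. -/
theorem Frame.exists_labelling {f g h : Face} (H : Frame f g h) :
    ∃ n : Equiv.Perm Face, IsLabelling n ∧ n F1 = f ∧ n F2 = g ∧ n F6 = opp f ∧ n F5 = opp g ∧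
      (n F4 = h ∧ n F3 = opp h ∨ n F3 = h ∧ n F4 = opp h) := by
  rcases H.cross_eq with hc | hc
  · obtain ⟨n, hn, e⟩ := H.isLabelling_labelFun hc
    exact ⟨n, hn, by simp [e, labelFun]⟩
  · obtain ⟨n, hn, e⟩ := H.opp_right.isLabelling_labelFun hc
    exact ⟨n, hn, by simp [e, labelFun]⟩

theorem IsLabelling.frame {n : Equiv.Perm Face} (hn : IsLabelling n) :
    Frame (n F1) (n F2) (n F4) ∧ n F6 = opp (n F1) ∧ n F5 = opp (n F2) ∧ n F3 = opp (n F4) := by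
  obtain ⟨h6, h4, h5, h3, -⟩ := hn
  have e6 : n F6 = opp (n F1) := normal_injective (by rw [h6, normal_opp])
  have hA : ∀ f g h, (crossProduct (normal f)) (normal g) = normal h → faceGraph.Adj f g := by
    simp only [cross_apply]
    decide
  have a12 := hA _ _ _ h4
  have a14 := hA _ _ _ h5
  have e5 : n F5 = opp (n F2) := by
    have : ∀ f g h k, (crossProduct (normal f)) (normal g) = normal h →
        (crossProduct (normal f)) (normal h) = normal k → k = opp g := by
      simp only [cross_apply]
      decide
    exact this _ _ _ _ h4 h5
  have e3 : n F3 = opp (n F4) := by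
    apply normal_injective
    rw [← h3, e5, normal_opp, map_neg, h4, normal_opp]
  have a24 : faceGraph.Adj (n F2) (n F4) := by
    change normal (n F2) ⬝ᵥ normal (n F4) = 0
    rw [← h4, dot_cross_self]
  exact ⟨⟨a12, a24, a14⟩, e6, e5, e3⟩

theorem ShortPath.isAmongFifteen {L : List Face} (h : ShortPath L) : IsAmongFifteen L := by
  cases h with
  | edge H =>
    obtain ⟨n, hn, h1, h2, h6, h5, -⟩ := H.exists_labelling
    exact ⟨n, hn, 0, by simp [fifteen, h1, h2]⟩
  | straight H =>
    obtain ⟨n, hn, h1, h2, h6, h5, -⟩ := H.exists_labelling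
    exact ⟨n, hn, 3, by simp [fifteen, h1, h2, h6]⟩
  | bend H =>
    obtain ⟨n, hn, h1, h2, h6, h5, ⟨h4, h3⟩ | ⟨h3, h4⟩⟩ := 
      H.swap.rotate.exists_labelling
    · exact ⟨n, hn, 2, by simp [fifteen, h1, h2, h4]⟩
    · exact ⟨n, hn, 1, by simp [fifteen, h1, h2, h3]⟩
  | zigzag H =>
    obtain ⟨n, hn, h1, h2, h6, h5, ⟨h4, h3⟩ | ⟨h3, h4⟩⟩ := H.exists_labelling
    · exact ⟨n, hn, 11, by simp [fifteen, h1, h2, h6, h4]⟩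
    · exact ⟨n, hn, 7, by simp [fifteen, h1, h2, h6, h3]⟩

/-- An invariant that excludes the starred landscapes, which have either five faces or four faces
with non-opposite ends. -/
theorem IsAmongFifteen.length {L : List Face} (h : IsAmongFifteen L) :
    L.length ≤ 3 ∨ L.length = 4 ∧ L.getLast? = L.head?.map opp := by
  obtain ⟨n, hn, i, rfl⟩ := h
  have h6 := hn.frame.2.1
  fin_cases i <;> simp [fifteen, h6]

theorem starred_isLandscape {n : Equiv.Perm Face} (hn : IsLabelling n) (i : Fin 5) :
    IsLandscape (starred n i) := by
  obtain ⟨H, h6, h5, h3⟩ := hn.frame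
  rw [isLandscape_iff]
  refine ⟨by fin_cases i <;> simp [starred], by fin_cases i <;> simp [starred], ?_⟩
  have a := H.fg
  have b := H.gh
  have c := H.fh
  fin_cases i <;> simp [starred, h6, h5, h3, adj_opp_left, adj_opp_right, a, b, c, a.symm,
    c.symm]

theorem starred_not_isAmongFifteen {n : Equiv.Perm Face} (hn : IsLabelling n) (i : Fin 5) :
    ¬ IsAmongFifteen (starred n i) := by
  intro h
  have h6 := hn.frame.2.1
  have := h.length
  fin_cases i <;> simp [starred, ← h6] at this

/-! ### Starred landscapes inside long paths -/

/-- A path contains one of the five starred landscapes for some labelling. -/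
def ContainsStarred (L : List Face) : Prop :=
  ∃ n : Equiv.Perm Face, IsLabelling n ∧ ∃ i : Fin 5, IsSublandscape (starred n i) L

theorem ContainsStarred.mono {K L : List Face} (hK : ContainsStarred K) (h : K <:+: L) :
    ContainsStarred L := by
  obtain ⟨n, hn, i, hi | hi⟩ := hK
  exacts [⟨n, hn, i, .inl (hi.trans h)⟩, ⟨n, hn, i, .inr (hi.trans h)⟩]

theorem ContainsStarred.reverse {L : List Face} (h : ContainsStarred L) :
    ContainsStarred L.reverse := by
  obtain ⟨n, hn, i, hi | hi⟩ := h
  · exact ⟨n, hn, i, .inr (List.reverse_infix.2 hi)⟩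
  · exact ⟨n, hn, i, .inl (by simpa using List.reverse_infix.2 hi)⟩

theorem containsStarred_fgFG {f g h : Face} (H : Frame f g h) :
    ContainsStarred [f, g, opp f, opp g] := by
  obtain ⟨n, hn, h1, h2, h6, h5, -⟩ := H.exists_labelling
  exact ⟨n, hn, 2, .inl (by simp [starred, h1, h2, h6, h5])⟩

theorem containsStarred_fgFh {f g h : Face} (H : Frame f g h) :
    ContainsStarred [f, g, opp f, h] := by
  obtain ⟨n, hn, h1, h2, h6, h5, ⟨h4, h3⟩ | ⟨h3, h4⟩⟩ := H.exists_labelling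
  · exact ⟨n, hn, 0, .inl (by simp [starred, h1, h2, h6, h4])⟩
  · exact ⟨n, hn, 1, .inl (by simp [starred, h1, h2, h6, h3])⟩

/-- Read backwards, this path goes straight across `h` from `opp g` to `g` and then turns to `f`. -/
theorem containsStarred_fghG {f g h : Face} (H : Frame f g h) :
    ContainsStarred [f, g, h, opp g] := by
  simpa using (containsStarred_fgFh H.rotate.opp_left).reverse

theorem containsStarred_fghFG {f g h : Face} (H : Frame f g h) :
    ContainsStarred [f, g, h, opp f, opp g] := by
  obtain ⟨n, hn, h1, h2, h6, h5, ⟨h4, h3⟩ | ⟨h3, h4⟩⟩ := H.exists_labelling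
  · exact ⟨n, hn, 3, .inl (by simp [starred, h1, h2, h6, h4, h5])⟩
  · exact ⟨n, hn, 4, .inl (by simp [starred, h1, h2, h6, h3, h5])⟩

theorem LongPath.containsStarred {L : List Face} (hL : LongPath L) : ContainsStarred L := by
  cases hL with
  | fgFG H => exact containsStarred_fgFG H
  | fgFh H => exact containsStarred_fgFh H
  | fghG H => exact containsStarred_fghG H
  | fgFGh H => exact (containsStarred_fgFG H).mono ⟨[], [_], rfl⟩
  | fgFhG H => exact (containsStarred_fgFh H).mono ⟨[], [_], rfl⟩
  | fghGF H => exact (containsStarred_fghG H).mono ⟨[], [_], rfl⟩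
  | fghGH H => exact (containsStarred_fghG H).mono ⟨[], [_], rfl⟩
  | fghFG H => exact containsStarred_fghFG H
  | fghFH H => exact (containsStarred_fghG H.opp_left.rotate).mono ⟨[_], [], rfl⟩
  | fgFhGH H => exact (containsStarred_fgFh H).mono ⟨[], [_, _], rfl⟩
  | fghGFH H => exact (containsStarred_fghG H).mono ⟨[], [_, _], rfl⟩
  | fghGHF H => exact (containsStarred_fghG H).mono ⟨[], [_, _], rfl⟩
  | fghFGH H => exact (containsStarred_fghFG H).mono ⟨[], [_], rfl⟩
  | fghFHG H => exact (containsStarred_fghG H.opp_left.rotate).mono ⟨[_], [_], rfl⟩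

/-! ### Layouts, trail lengths and surface distance -/

theorem co_unroll_opp_left {f g : Face} (h : faceGraph.Adj f g) (x : E3) :
    co f (unroll (opp f) g x) = -co g x := by
  have := co_unroll_left (adj_opp_left.2 h) x
  rw [co_opp] at this
  linarith

theorem co_unroll_opp_right {f g : Face} (h : faceGraph.Adj f g) (x : E3) :
    co g (unroll f (opp g) x) = co f x - 1 := by
  have := co_unroll_right (adj_opp_right.2 h) x
  rw [co_opp] at this
  linarith

theorem unroll_of_co_eq {f g : Face} {x : E3} (hf : co f x = 1 / 2) (hg : co g x = 1 / 2) :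
    unroll f g x = x := by
  rw [unroll_eq, hf, hg]; norm_num

/-- The composite of the unrollings along a path, applied to a point of its last face. -/
noncomputable def unrollPath : List Face → E3 → E3
  | f :: g :: L, x => unroll f g (unrollPath (g :: L) x)
  | _, x => x

/-- The position of a face depends only on the part of the path leading up to it; the hypothesis `k
∉ A` is needed because `develop` stops at the first occurrence of `k`. -/
theorem develop_eq_unrollPath : ∀ {A : List Face} {k : Face} (B : List Face) (x : E3), k ∉ A →
    develop (A ++ k :: B) k x = unrollPath (A ++ [k]) x
  | [], k, [], x, _ => rfl
  | [], k, _ :: _, x, _ => by simp [develop, unrollPath]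
  | [f], k, B, x, h => by
    have ih := develop_eq_unrollPath (A := []) B x (k := k) (by simp)
    simp only [List.nil_append] at ih
    simp only [List.mem_singleton] at h
    simp [develop, unrollPath, h, ih]
  | f :: g :: A, k, B, x, h => by
    simp only [List.mem_cons, not_or] at h
    have ih := develop_eq_unrollPath (A := g :: A) B x (k := k) (by simpa using h.2)
    simp only [List.cons_append] at ih ⊢
    simp only [develop, unrollPath, h.1, if_false, ih]

theorem develop_cons_cons_of_ne {f g k : Face} {L : List Face} (h : k ≠ f) (x : E3) :
    develop (f :: g :: L) k x = unroll f g (develop (g :: L) k x) := by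
  simp [develop, h]

theorem develop_head (f : Face) (L : List Face) (x : E3) : develop (f :: L) f x = x := by
  cases L <;> simp [develop]

theorem trailLength_le {L : List Face} {p q : E3} {h k : Face} (hh : h ∈ L) (hp : p ∈ faceSet h)
    (hk : k ∈ L) (hq : q ∈ faceSet k)
    (hs : segment ℝ (develop L h p) (develop L k q) ⊆ region L) :
    trailLength L p q ≤ edist (develop L h p) (develop L k q) :=
  iInf₂_le_of_le _ ⟨h, hh, hp, rfl⟩ <| iInf₂_le_of_le _ ⟨k, hk, hq, rfl⟩ <| iInf_le _ hs

theorem trailLength_comm (L : List Face) (p q : E3) : trailLength L p q = trailLength L q p := by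
  have key : ∀ p q, trailLength L p q ≤ trailLength L q p := fun p q =>
    le_iInf₂ fun x hx => le_iInf₂ fun y hy => le_iInf fun hs => by
      rw [edist_comm]
      rw [segment_symm] at hs
      exact iInf₂_le_of_le y hy <| iInf₂_le_of_le x hx <| iInf_le _ hs
  exact le_antisymm (key p q) (key q p)

theorem surfaceDist_comm (p q : E3) : surfaceDist p q = surfaceDist q p := by
  simp only [surfaceDist, trailLength_comm _ p q]

theorem surfaceDist_le_trailLength {L : List Face} (h : IsLandscape L) (p q : E3) :
    surfaceDist p q ≤ trailLength L p q := iInf₂_le L h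

theorem ShortPath.isLandscape {L : List Face} (h : ShortPath L) : IsLandscape L := by
  rw [isLandscape_iff]
  cases h
  all_goals
    rename_i H
    have a := H.fg
    have b := H.gh
    have c := H.fh
    simp [adj_opp_left, adj_opp_right, a, b, c, a.symm, b.symm, c.symm, a.ne, b.ne, c.ne, ne_opp]
  all_goals
    try rename_i f g h
    have a' : f ≠ opp f := ne_opp f
    grind [not_adj_opp, adj_opp_left, SimpleGraph.Adj.ne]

/-- The points of a path are strictly closer on the surface than `r`, or are joined by a trail
of length at most `r` in one of its short subpaths. -/
def Shortenable (L : List Face) (p q : E3) (r : ℝ≥0∞) : Prop :=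
  surfaceDist p q < r ∨
    ∃ K, K <:+: L ∧ ShortPath K ∧ p ∈ points K ∧ q ∈ points K ∧ trailLength K p q ≤ r

theorem Shortenable.mono {K L : List Face} {p q : E3} {r : ℝ≥0∞} (h : Shortenable K p q r)
    (hKL : K <:+: L) : Shortenable L p q r := by
  rcases h with h | ⟨K', h1, h2⟩
  exacts [.inl h, .inr ⟨K', h1.trans hKL, h2⟩]

theorem Shortenable.symm {L : List Face} {p q : E3} {r : ℝ≥0∞} (h : Shortenable L p q r) :
    Shortenable L q p r := by
  rcases h with h | ⟨K, h1, h2, h3, h4, h5⟩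
  · exact .inl (surfaceDist_comm p q ▸ h)
  · exact .inr ⟨K, h1, h2, h4, h3, trailLength_comm K p q ▸ h5⟩

theorem mem_points {L : List Face} {h : Face} (hL : h ∈ L) {p : E3} (hp : p ∈ faceSet h) :
    p ∈ points L := Set.mem_biUnion hL hp

theorem mem_region_of {A : List Face} {k : Face} (B : List Face) (hk : k ∉ A) {w : E3}
    (hw : w ∈ faceSet k) : unrollPath (A ++ [k]) w ∈ region (A ++ k :: B) :=
  Set.mem_biUnion (by simp : k ∈ A ++ k :: B) ⟨w, hw, develop_eq_unrollPath B w hk⟩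

theorem co_segment {x y z : E3} (hz : z ∈ segment ℝ x y) :
    ∃ a b : ℝ, 0 ≤ a ∧ 0 ≤ b ∧ a + b = 1 ∧ ∀ f, co f z = a * co f x + b * co f y := by
  obtain ⟨a, b, ha, hb, hab, rfl⟩ := hz
  exact ⟨a, b, ha, hb, hab, fun f => by rw [co_add, co_smul, co_smul]⟩

/-! ### Squares and segments in the layouts of the short paths -/

/-- In the plane of `f` with coordinates `(co g, co h)`, the face `f` is the unit square centred at
`(0, 0)`, `g` the one at `(1, 0)`, and `h` after `g` the one at `(1, 1)`; `opp f` is at `(2, 0)`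
after `g` and at `(2, 1)` after `h`. This lemma and the next four read off these squares. -/
theorem Frame.mem_region_first {f g h : Face} (H : Frame f g h) (L : List Face) {z : E3}
    (h1 : co f z = 1 / 2) (h2 : -(1 / 2) ≤ co g z)
    (h3 : co g z ≤ 1 / 2) (h4 : -(1 / 2) ≤ co h z) (h5 : co h z ≤ 1 / 2) : z ∈ region (f :: L) :=
  mem_region_of (A := []) L (by simp) ((mem_faceSet_iff H).2 ⟨h1, ⟨h2, h3⟩, h4, h5⟩)

theorem Frame.mem_region_second {f g h : Face} (H : Frame f g h) (L : List Face) {z : E3}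
    (h1 : co f z = 1 / 2) (h2 : 1 / 2 ≤ co g z)
    (h3 : co g z ≤ 3 / 2) (h4 : -(1 / 2) ≤ co h z) (h5 : co h z ≤ 1 / 2) :
    z ∈ region (f :: g :: L) := by
  have a := H.fg
  have b := H.gh
  have c := H.fh
  have := mem_region_of (A := [f]) L (k := g) (w := unroll g f z) (by simpa using a.ne')
    ((mem_faceSet_iff H.swap).2 (by
      simp only [co_unroll_left, co_unroll_right, co_unroll_of_adj, a, b, c, a.symm, b.symm, c.symm]
      exact ⟨h1, ⟨by linarith, by linarith⟩, h4, h5⟩))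
  simpa [unrollPath, unroll_unroll a] using this

theorem Frame.mem_region_third {f g h : Face} (H : Frame f g h) (L : List Face) {z : E3}
    (h1 : co f z = 1 / 2) (h2 : 1 / 2 ≤ co g z)
    (h3 : co g z ≤ 3 / 2) (h4 : 1 / 2 ≤ co h z) (h5 : co h z ≤ 3 / 2) :
    z ∈ region (f :: g :: h :: L) := by
  have a := H.fg
  have b := H.gh
  have c := H.fh
  have := mem_region_of (A := [f, g]) L (k := h) (w := unroll h g (unroll g f z))
    (by simp [b.ne', c.ne'])
    ((mem_faceSet_iff H.swap.rotate.rotate).2 (by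
      simp only [co_unroll_left, co_unroll_right, co_unroll_of_adj, a, b, c, a.symm, b.symm, c.symm]
      exact ⟨h1, ⟨by linarith, by linarith⟩, by linarith, by linarith⟩))
  simpa [unrollPath, unroll_unroll a, unroll_unroll b] using this

theorem Frame.mem_region_straight {f g h : Face} (H : Frame f g h) {z : E3}
    (h1 : co f z = 1 / 2) (h2 : 3 / 2 ≤ co g z)
    (h3 : co g z ≤ 5 / 2) (h4 : -(1 / 2) ≤ co h z) (h5 : co h z ≤ 1 / 2) :
    z ∈ region [f, g, opp f] := by
  have a := H.fg
  have b := H.gh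
  have c := H.fh
  have := mem_region_of (A := [f, g]) [] (k := opp f) (w := unroll (opp f) g (unroll g f z))
    (by simp [(ne_opp f).symm, (adj_opp_left.2 a).ne])
    ((mem_faceSet_iff H.opp_left).2 (by
      simp only [co_unroll_left, co_unroll_right, co_unroll_of_adj, a, b, c, a.symm, b.symm, c.symm,
        adj_opp_left, adj_opp_right, co_opp]
      exact ⟨h1, ⟨by linarith, by linarith⟩, by linarith, by linarith⟩))
  simpa [unrollPath, unroll_unroll a, unroll_unroll (adj_opp_right.2 a.symm)] using this

theorem Frame.mem_region_zigzag {f g h : Face} (H : Frame f g h) {z : E3}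
    (h1 : co f z = 1 / 2) (h2 : 3 / 2 ≤ co g z)
    (h3 : co g z ≤ 5 / 2) (h4 : 1 / 2 ≤ co h z) (h5 : co h z ≤ 3 / 2) :
    z ∈ region [f, g, h, opp f] := by
  have a := H.fg
  have b := H.gh
  have c := H.fh
  have := mem_region_of (A := [f, g, h]) [] (k := opp f)
    (w := unroll (opp f) h (unroll h g (unroll g f z)))
    (by simp [(ne_opp f).symm, (adj_opp_left.2 a).ne, (adj_opp_left.2 c).ne])
    ((mem_faceSet_iff H.opp_left).2 (by
      simp only [co_unroll_left, co_unroll_right, co_unroll_of_adj, a, b, c, a.symm, b.symm, c.symm,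
        adj_opp_left, adj_opp_right, co_opp]
      exact ⟨h1, ⟨by linarith, by linarith⟩, by linarith, by linarith⟩))
  simpa [unrollPath, unroll_unroll a, unroll_unroll b, unroll_unroll (adj_opp_right.2 c.symm)]
    using this

theorem Frame.segment_subset_region_edge {f g h : Face} (H : Frame f g h) {x y : E3}
    (hx : co f x = 1 / 2 ∧ (-(1 / 2) ≤ co g x ∧ co g x ≤ 3 / 2) ∧
      (-(1 / 2) ≤ co h x ∧ co h x ≤ 1 / 2))
    (hy : co f y = 1 / 2 ∧ (-(1 / 2) ≤ co g y ∧ co g y ≤ 3 / 2) ∧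
      (-(1 / 2) ≤ co h y ∧ co h y ≤ 1 / 2)) :
    segment ℝ x y ⊆ region [f, g] := by
  intro z hz
  obtain ⟨a, b, ha, hb, hab, hc⟩ := co_segment hz
  obtain ⟨x1, ⟨x2, x3⟩, x4, x5⟩ := hx
  obtain ⟨y1, ⟨y2, y3⟩, y4, y5⟩ := hy
  have z1 : co f z = 1 / 2 := by rw [hc, x1, y1]; linarith
  have z2 : -(1 / 2) ≤ co g z := by rw [hc]; nlinarith
  have z3 : co g z ≤ 3 / 2 := by rw [hc]; nlinarith
  have z4 : -(1 / 2) ≤ co h z := by rw [hc]; nlinarith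
  have z5 : co h z ≤ 1 / 2 := by rw [hc]; nlinarith
  rcases le_total (co g z) (1 / 2) with hz | hz
  · exact H.mem_region_first _ z1 z2 hz z4 z5
  · exact H.mem_region_second _ z1 hz z3 z4 z5

theorem Frame.segment_subset_region_straight {f g h : Face} (H : Frame f g h) {x y : E3}
    (hx : co f x = 1 / 2 ∧ (-(1 / 2) ≤ co g x ∧ co g x ≤ 5 / 2) ∧
      (-(1 / 2) ≤ co h x ∧ co h x ≤ 1 / 2))
    (hy : co f y = 1 / 2 ∧ (-(1 / 2) ≤ co g y ∧ co g y ≤ 5 / 2) ∧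
      (-(1 / 2) ≤ co h y ∧ co h y ≤ 1 / 2)) :
    segment ℝ x y ⊆ region [f, g, opp f] := by
  intro z hz
  obtain ⟨a, b, ha, hb, hab, hc⟩ := co_segment hz
  obtain ⟨x1, ⟨x2, x3⟩, x4, x5⟩ := hx
  obtain ⟨y1, ⟨y2, y3⟩, y4, y5⟩ := hy
  have z1 : co f z = 1 / 2 := by rw [hc, x1, y1]; linarith
  have z2 : -(1 / 2) ≤ co g z := by rw [hc]; nlinarith
  have z3 : co g z ≤ 5 / 2 := by rw [hc]; nlinarith
  have z4 : -(1 / 2) ≤ co h z := by rw [hc]; nlinarith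
  have z5 : co h z ≤ 1 / 2 := by rw [hc]; nlinarith
  rcases le_total (co g z) (1 / 2) with hz | hz
  · exact H.mem_region_first _ z1 z2 hz z4 z5
  rcases le_total (co g z) (3 / 2) with hz' | hz'
  · exact H.mem_region_second _ z1 hz hz' z4 z5
  · exact H.mem_region_straight z1 hz' z3 z4 z5

/-- A segment running from the quadrant `x ≤ 0, y ≤ 0` to the half plane `x' ≥ 0` and passing below
the origin stays in `y ≤ 0` as long as it stays in `x < 0`. -/
theorem combination_nonpos {x y x' y' a b : ℝ} (hx : x ≤ 0) (hx' : 0 ≤ x') (hy : y ≤ 0)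
    (hb : 0 ≤ b) (h : x' * y ≤ x * y') (hlt : a * x + b * x' < 0) :
    a * y + b * y' ≤ 0 := by
  rcases hx.lt_or_eq with h0 | h0
  · by_contra! hc
    have h1 := mul_neg_of_neg_of_pos h0 hc
    have h2 := mul_nonneg_of_nonpos_of_nonpos hlt.le hy
    have h3 := mul_le_mul_of_nonneg_left h hb
    linarith
  · subst h0
    linarith [mul_nonneg hb hx']

theorem Frame.segment_subset_region_bend {f g h : Face} (H : Frame f g h) {x y : E3}
    (hx : co f x = 1 / 2 ∧ (-(1 / 2) ≤ co g x ∧ co g x ≤ 1 / 2) ∧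
      (-(1 / 2) ≤ co h x ∧ co h x ≤ 1 / 2))
    (hy : co f y = 1 / 2 ∧ (1 / 2 ≤ co g y ∧ co g y ≤ 3 / 2) ∧
      (1 / 2 ≤ co h y ∧ co h y ≤ 3 / 2))
    (hxy : (co g y - 1 / 2) * (co h x - 1 / 2) ≤ (co g x - 1 / 2) * (co h y - 1 / 2)) :
    segment ℝ x y ⊆ region [f, g, h] := by
  intro z hz
  obtain ⟨a, b, ha, hb, hab, hc⟩ := co_segment hz
  obtain ⟨x1, ⟨x2, x3⟩, x4, x5⟩ := hx
  obtain ⟨y1, ⟨y2, y3⟩, y4, y5⟩ := hy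
  have z1 : co f z = 1 / 2 := by rw [hc, x1, y1]; linarith
  have z2 : -(1 / 2) ≤ co g z := by rw [hc]; nlinarith
  have z3 : co g z ≤ 3 / 2 := by rw [hc]; nlinarith
  have z4 : -(1 / 2) ≤ co h z := by rw [hc]; nlinarith
  have z5 : co h z ≤ 3 / 2 := by rw [hc]; nlinarith
  rcases lt_or_ge (co g z) (1 / 2) with hz | hz
  · have := combination_nonpos (a := a) (b := b) (by linarith) (by linarith)
      (by linarith) hb hxy
      (by linarith [hc g])
    exact H.mem_region_first _ z1 z2 hz.le z4 (by linarith [hc h])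
  rcases le_total (co h z) (1 / 2) with hz' | hz'
  · exact H.mem_region_second _ z1 hz z3 z4 hz'
  · exact H.mem_region_third _ z1 hz z3 hz' z5

/-- The layout has reflex corners at `(1/2, 1/2)` and `(3/2, 1/2)`. The two determinant conditions
say that the segment passes below the first and above the second. -/
theorem Frame.segment_subset_region_zigzag {f g h : Face} (H : Frame f g h) {x y : E3}
    (hx : co f x = 1 / 2 ∧ (-(1 / 2) ≤ co g x ∧ co g x ≤ 1 / 2) ∧
      (-(1 / 2) ≤ co h x ∧ co h x ≤ 1 / 2))
    (hy : co f y = 1 / 2 ∧ (3 / 2 ≤ co g y ∧ co g y ≤ 5 / 2) ∧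
      (1 / 2 ≤ co h y ∧ co h y ≤ 3 / 2))
    (hxy : (co g y - 1 / 2) * (co h x - 1 / 2) ≤ (co g x - 1 / 2) * (co h y - 1 / 2))
    (hyx : (co g y - 3 / 2) * (co h x - 1 / 2) ≥ (co g x - 3 / 2) * (co h y - 1 / 2)) :
    segment ℝ x y ⊆ region [f, g, h, opp f] := by
  intro z hz
  obtain ⟨a, b, ha, hb, hab, hc⟩ := co_segment hz
  obtain ⟨x1, ⟨x2, x3⟩, x4, x5⟩ := hx
  obtain ⟨y1, ⟨y2, y3⟩, y4, y5⟩ := hy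
  have z1 : co f z = 1 / 2 := by rw [hc, x1, y1]; linarith
  have z2 : -(1 / 2) ≤ co g z := by rw [hc]; nlinarith
  have z3 : co g z ≤ 5 / 2 := by rw [hc]; nlinarith
  have z4 : -(1 / 2) ≤ co h z := by rw [hc]; nlinarith
  have z5 : co h z ≤ 3 / 2 := by rw [hc]; nlinarith
  rcases lt_or_ge (co g z) (1 / 2) with hz | hz
  · have := combination_nonpos (a := a) (b := b) (by linarith) (by linarith)
      (by linarith) hb hxy
      (by linarith [hc g])
    exact H.mem_region_first _ z1 z2 hz.le z4 (by linarith [hc h])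
  rcases lt_or_ge (3 / 2) (co g z) with hz' | hz'
  -- The second corner is treated as the first, after a half turn about it that exchanges the roles
  -- of the end points.
  · have := combination_nonpos (x := 3 / 2 - co g y) (x' := 3 / 2 - co g x)
      (y := 1 / 2 - co h y) (y' := 1 / 2 - co h x) (a := b) (b := a) (by linarith) (by linarith)
      (by linarith) ha (by linarith) (by linarith [hc g])
    exact H.mem_region_zigzag z1 hz'.le z3 (by linarith [hc h]) z5
  rcases le_total (co h z) (1 / 2) with hw | hw
  · exact H.mem_region_second _ z1 hz hz' z4 hw
  · exact H.mem_region_third _ z1 hz hz' hw z5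

/-! ### Comparison for the short paths -/

theorem trailLength_le_unrollPath {f k : Face} {A : List Face} {p q : E3} (hk : k ∉ f :: A)
    (hp : p ∈ faceSet f) (hq : q ∈ faceSet k)
    (hs : segment ℝ p (unrollPath (f :: A ++ [k]) q) ⊆ region (f :: A ++ [k])) :
    trailLength (f :: A ++ [k]) p q ≤ edist p (unrollPath (f :: A ++ [k]) q) := by
  have e1 : develop (f :: A ++ [k]) f p = p := develop_head f _ p
  have e2 : develop (f :: A ++ [k]) k q = unrollPath (f :: A ++ [k]) q :=
    develop_eq_unrollPath [] q hk
  have := trailLength_le (L := f :: A ++ [k]) (by simp) hp (by simp) hq (by rwa [e1, e2])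
  rwa [e1, e2] at this

namespace Frame

variable {f g h : Face} {p q : E3}

theorem trailLength_edge_le (H : Frame f g h) (hp : p ∈ faceSet f) (hq : q ∈ faceSet g) :
    trailLength [f, g] p q ≤ edist p (unrollPath [f, g] q) := by
  refine trailLength_le_unrollPath (A := []) (by simpa using H.fg.ne') hp hq ?_
  rw [mem_faceSet_iff H] at hp
  rw [mem_faceSet_iff H.swap] at hq
  refine H.segment_subset_region_edge ⟨hp.1, ⟨hp.2.1.1, by linarith⟩, hp.2.2⟩ ?_
  simp only [List.cons_append, List.nil_append, unrollPath, co_unroll_left, co_unroll_right,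
    co_unroll_of_adj, H.fg, H.fh.symm, H.gh.symm]
  exact ⟨hq.1, ⟨by linarith, by linarith⟩, hq.2.2⟩

theorem trailLength_straight_le (H : Frame f g h) (hp : p ∈ faceSet f)
    (hq : q ∈ faceSet (opp f)) :
    trailLength [f, g, opp f] p q ≤ edist p (unrollPath [f, g, opp f] q) := by
  refine trailLength_le_unrollPath (A := [g])
    (by simp [(ne_opp f).symm, (adj_opp_left.2 H.fg).ne]) hp hq ?_
  rw [mem_faceSet_iff H] at hp
  rw [mem_faceSet_iff H.opp_left, co_opp] at hq
  refine H.segment_subset_region_straight ⟨hp.1, ⟨hp.2.1.1, by linarith⟩, hp.2.2⟩ ?_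
  simp only [List.cons_append, List.nil_append, unrollPath, co_unroll_left, co_unroll_right,
    co_unroll_of_adj, co_unroll_opp_left, co_unroll_opp_right, adj_opp_left, adj_opp_right, co_opp,
    H.fg, H.fg.symm, H.fh.symm, H.gh.symm]
  exact ⟨by linarith, ⟨by linarith, by linarith⟩, hq.2.2⟩

theorem surfaceDist_le_edge (H : Frame f g h) (hp : p ∈ faceSet f) (hq : q ∈ faceSet g) :
    surfaceDist p q ≤ edist p (unrollPath [f, g] q) :=
  (surfaceDist_le_trailLength (ShortPath.edge H).isLandscape p q).trans (H.trailLength_edge_le hp hq)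

theorem surfaceDist_le_straight (H : Frame f g h) (hp : p ∈ faceSet f) (hq : q ∈ faceSet (opp f)) :
    surfaceDist p q ≤ edist p (unrollPath [f, g, opp f] q) :=
  (surfaceDist_le_trailLength (ShortPath.straight H).isLandscape p q).trans
    (H.trailLength_straight_le hp hq)

/-- If the segment misses the layout, it passes the vertex common to `f, g, h` on the side away from
`g`. Laying `h` out directly next to `f` turns `q` by a right angle about this vertex, towards `p`,
which shortens the distance strictly. -/
theorem trailLength_bend_le_or (H : Frame f g h) (hp : p ∈ faceSet f) (hq : q ∈ faceSet h) :
    trailLength [f, g, h] p q ≤ edist p (unrollPath [f, g, h] q) ∨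
      surfaceDist p q < edist p (unrollPath [f, g, h] q) := by
  have hp' := (mem_faceSet_iff H).1 hp
  have hq' := (mem_faceSet_iff H.swap.rotate.rotate).1 hq
  rcases le_or_gt ((1 / 2 - co f q) * (co h p - 1 / 2)) ((co g p - 1 / 2) * (1 / 2 - co g q))
    with hc | hc
  · left
    refine trailLength_le_unrollPath (A := [g]) (by simp [H.fh.ne', H.gh.ne']) hp hq ?_
    have e1 : co g (unrollPath [f, g, h] q) = 1 - co f q := by
      simp [unrollPath, co_unroll_left, co_unroll_right, co_unroll_of_adj, H.fg, H.gh, H.fh]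
    have e2 : co h (unrollPath [f, g, h] q) = 1 - co g q := by
      simp [unrollPath, co_unroll_left, co_unroll_right, co_unroll_of_adj, H.fg, H.gh, H.fh,
        H.gh.symm, H.fh.symm]
    have e3 : co f (unrollPath [f, g, h] q) = co h q := by
      simp [unrollPath, co_unroll_left, co_unroll_right, co_unroll_of_adj, H.fg, H.gh, H.fh]
    refine H.segment_subset_region_bend hp' ?_ ?_ <;>
      simp only [List.cons_append, List.nil_append, e1, e2, e3]
    · exact ⟨hq'.1, ⟨by linarith, by linarith⟩, by linarith, by linarith⟩
    · linarith
  · right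
    refine (H.swap.rotate.surfaceDist_le_edge hp hq).trans_lt (edist_lt_of_sq ?_)
    obtain ⟨p1, ⟨p2, p3⟩, p4, p5⟩ := hp'
    obtain ⟨q1, ⟨q2, q3⟩, q4, q5⟩ := hq'
    simp only [dist_sq_eq H, unrollPath, co_unroll_left, co_unroll_right,
      co_unroll_of_adj, H.fg, H.fg.symm, H.fh, H.fh.symm, H.gh, H.gh.symm, p1, q1]
    -- Relative to the vertex, let `p` be `(-a, -b)` and the laid out `q` be `(c, d)`, all four
    -- numbers nonnegative. The direct layout puts `q` at `(-d, c)`, and the squared distances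
    -- differ by `2(ac + bd) + 2(ad - bc)`, where `hc` says `ad > bc`.
    nlinarith [mul_nonneg (sub_nonneg.2 p3) (sub_nonneg.2 q3), mul_nonneg (sub_nonneg.2 p5) (sub_nonneg.2 q5),
      mul_nonneg (sub_nonneg.2 p3) (sub_nonneg.2 q5), mul_nonneg (sub_nonneg.2 p5) (sub_nonneg.2 q3)]

/-- The segment can fail at either of the two reflex corners. A right-angle turn about the first
replaces the path by `f, h, opp f`, about the second by `f, g, opp f`; either is strictly shorter,
as for a bend. -/
theorem trailLength_zigzag_le_or (H : Frame f g h) (hp : p ∈ faceSet f)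
    (hq : q ∈ faceSet (opp f)) :
    trailLength [f, g, h, opp f] p q ≤ edist p (unrollPath [f, g, h, opp f] q) ∨
      surfaceDist p q < edist p (unrollPath [f, g, h, opp f] q) := by
  have hp' := (mem_faceSet_iff H).1 hp
  have hq' := (mem_faceSet_iff H.opp_left).1 hq
  rw [co_opp] at hq'
  have e1 : co g (unrollPath [f, g, h, opp f] q) = 2 - co h q := by
    simp [unrollPath, co_unroll_left, co_unroll_right, co_unroll_of_adj, co_unroll_opp_left,
      co_unroll_opp_right, adj_opp_left, adj_opp_right, co_opp, H.fg, H.gh, H.fh, H.fg.symm,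
      H.fh.symm, H.gh.symm]
    ring
  have e2 : co h (unrollPath [f, g, h, opp f] q) = 1 - co g q := by
    simp [unrollPath, co_unroll_left, co_unroll_right, co_unroll_of_adj, co_unroll_opp_left,
      co_unroll_opp_right, adj_opp_left, adj_opp_right, co_opp, H.fg, H.gh, H.fh, H.fg.symm,
      H.fh.symm, H.gh.symm]
  have e3 : co f (unrollPath [f, g, h, opp f] q) = -co f q := by
    simp [unrollPath, co_unroll_left, co_unroll_right, co_unroll_of_adj, co_unroll_opp_left,
      co_unroll_opp_right, adj_opp_left, adj_opp_right, co_opp, H.fg, H.gh, H.fh, H.fg.symm,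
      H.fh.symm, H.gh.symm]
  rcases lt_or_ge ((co g p - 1 / 2) * (1 / 2 - co g q)) ((3 / 2 - co h q) * (co h p - 1 / 2))
    with hc | hc
  · right
    refine (H.swap.rotate.surfaceDist_le_straight hp hq).trans_lt (edist_lt_of_sq ?_)
    obtain ⟨p1, ⟨p2, p3⟩, p4, p5⟩ := hp'
    obtain ⟨q1, ⟨q2, q3⟩, q4, q5⟩ := hq'
    simp only [dist_sq_eq H, e1, e2, e3]
    simp only [unrollPath, co_unroll_left, co_unroll_right, co_unroll_opp_left,
      co_unroll_opp_right, adj_opp_left, adj_opp_right, co_opp,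
      co_unroll_of_adj, H.fg, H.fg.symm, H.fh, H.fh.symm, H.gh, H.gh.symm, p1]
    nlinarith [mul_nonneg (sub_nonneg.2 p3) (sub_nonneg.2 q3), mul_nonneg (sub_nonneg.2 p5) (sub_nonneg.2 q5),
      mul_nonneg (sub_nonneg.2 p3) (sub_nonneg.2 q5), mul_nonneg (sub_nonneg.2 p5) (sub_nonneg.2 q3)]
  rcases lt_or_ge ((1 / 2 - co h q) * (co h p - 1 / 2)) ((co g p - 3 / 2) * (1 / 2 - co g q))
    with hc' | hc'
  · right
    refine (H.surfaceDist_le_straight hp hq).trans_lt (edist_lt_of_sq ?_)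
    obtain ⟨p1, ⟨p2, p3⟩, p4, p5⟩ := hp'
    obtain ⟨q1, ⟨q2, q3⟩, q4, q5⟩ := hq'
    simp only [dist_sq_eq H, e1, e2, e3]
    simp only [unrollPath, co_unroll_left, co_unroll_right, co_unroll_opp_left,
      co_unroll_opp_right, adj_opp_left, adj_opp_right, co_opp,
      co_unroll_of_adj, H.fg, H.fg.symm, H.fh, H.fh.symm, H.gh, H.gh.symm, p1]
    nlinarith [mul_nonneg (sub_nonneg.2 p3) (sub_nonneg.2 q3), mul_nonneg (sub_nonneg.2 p5) (sub_nonneg.2 q5),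
      mul_nonneg (sub_nonneg.2 p3) (sub_nonneg.2 q5), mul_nonneg (sub_nonneg.2 p5) (sub_nonneg.2 q3)]
  · left
    refine trailLength_le_unrollPath (A := [g, h])
      (by simp [(ne_opp f).symm, (adj_opp_left.2 H.fg).ne, (adj_opp_left.2 H.fh).ne]) hp hq ?_
    refine H.segment_subset_region_zigzag hp' ?_ ?_ ?_ <;>
      simp only [List.cons_append, List.nil_append, e1, e2, e3]
    · exact ⟨hq'.1, ⟨by linarith, by linarith⟩, by linarith, by linarith⟩
    · linarith
    · linarith

/-- The planar distance bounds the surface distance even if the segment leaves the layout, so bends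
can serve as competitors without a visibility check. -/
theorem surfaceDist_le_bend (H : Frame f g h) (hp : p ∈ faceSet f) (hq : q ∈ faceSet h) :
    surfaceDist p q ≤ edist p (unrollPath [f, g, h] q) := by
  rcases H.trailLength_bend_le_or hp hq with h1 | h1
  · exact (surfaceDist_le_trailLength (ShortPath.bend H).isLandscape p q).trans h1
  · exact h1.le

end Frame

/-! ### Comparison for the long paths -/

theorem Frame.opp_mid {f g h : Face} (H : Frame f g h) : Frame f (opp g) h :=
  H.swap.opp_left.swap

theorem mul_nonneg_of_mem_box {x y : ℝ} (hx : -(1 / 2) ≤ x ∧ x ≤ 1 / 2)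
    (hy : -(1 / 2) ≤ y ∧ y ≤ 1 / 2) :
    0 ≤ (1 / 2 - x) * (1 / 2 - y) ∧ 0 ≤ (1 / 2 + x) * (1 / 2 - y) ∧
      0 ≤ (1 / 2 - x) * (1 / 2 + y) ∧ 0 ≤ (1 / 2 + x) * (1 / 2 + y) := by
  have h1 : 0 ≤ 1 / 2 - x := by linarith
  have h2 : 0 ≤ 1 / 2 + x := by linarith
  have h3 : 0 ≤ 1 / 2 - y := by linarith
  have h4 : 0 ≤ 1 / 2 + y := by linarith
  exact ⟨mul_nonneg h1 h3, mul_nonneg h2 h3, mul_nonneg h1 h4, mul_nonneg h2 h4⟩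

theorem Shortenable.of_edge {f g h : Face} {p q : E3} (H : Frame f g h) (hp : p ∈ faceSet f)
    (hq : q ∈ faceSet g) : Shortenable [f, g] p q (edist p (unrollPath [f, g] q)) :=
  .inr ⟨_, List.infix_rfl, .edge H, mem_points (by simp) hp, mem_points (by simp) hq,
    H.trailLength_edge_le hp hq⟩

theorem Shortenable.of_straight {f g h : Face} {p q : E3} (H : Frame f g h) (hp : p ∈ faceSet f)
    (hq : q ∈ faceSet (opp f)) :
    Shortenable [f, g, opp f] p q (edist p (unrollPath [f, g, opp f] q)) :=
  .inr ⟨_, List.infix_rfl, .straight H, mem_points (by simp) hp, mem_points (by simp) hq,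
    H.trailLength_straight_le hp hq⟩

theorem Shortenable.of_bend {f g h : Face} {p q : E3} (H : Frame f g h) (hp : p ∈ faceSet f)
    (hq : q ∈ faceSet h) : Shortenable [f, g, h] p q (edist p (unrollPath [f, g, h] q)) := by
  rcases H.trailLength_bend_le_or hp hq with h1 | h1
  · exact .inr ⟨_, List.infix_rfl, .bend H, mem_points (by simp) hp, mem_points (by simp) hq, h1⟩
  · exact .inl h1

theorem Shortenable.of_zigzag {f g h : Face} {p q : E3} (H : Frame f g h) (hp : p ∈ faceSet f)
    (hq : q ∈ faceSet (opp f)) :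
    Shortenable [f, g, h, opp f] p q (edist p (unrollPath [f, g, h, opp f] q)) := by
  rcases H.trailLength_zigzag_le_or hp hq with h1 | h1
  · exact .inr ⟨_, List.infix_rfl, .zigzag H, mem_points (by simp) hp, mem_points (by simp) hq, h1⟩
  · exact .inl h1

/-- To shorten a path it suffices to do so when its initial point is not on the second face, and
to shorten the rest of the path when it is. -/
theorem Shortenable.cons {f g h : Face} {L : List Face} {p q : E3} (H : Frame f g h)
    (hp : p ∈ faceSet f)
    (hlt : co g p < 1 / 2 → surfaceDist p q < edist p (unrollPath (f :: g :: L) q))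
    (hs : p ∈ faceSet g → Shortenable (g :: L) p q (edist p (unrollPath (g :: L) q))) :
    Shortenable (f :: g :: L) p q (edist p (unrollPath (f :: g :: L) q)) := by
  obtain ⟨h1, ⟨h2, h3⟩, h4⟩ := (mem_faceSet_iff H).1 hp
  rcases h3.lt_or_eq with h3 | h3
  · exact .inl (hlt h3)
  · have hu := unroll_of_co_eq h1 h3
    -- A point on the common edge is fixed by the rotation about it, so the outermost unrolling acts
    -- on both points and can be dropped.
    rw [unrollPath, ← hu, edist_unroll H.fg, hu]
    exact (hs ((mem_faceSet_iff H.swap).2 ⟨h3, ⟨by linarith, h1.le⟩, h4⟩)).mono ⟨[f], [], by simp⟩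

namespace Shortenable

variable {f g h : Face} {p q : E3}

/-- The competitor is the direct pair `f, opp g`. As in most of the cases below, it is not a
subpath, so a strict inequality is needed; strictness comes from `p` lying off the edge towards `g`.
-/
theorem fgFG (H : Frame f g h) (hp : p ∈ faceSet f) (hq : q ∈ faceSet (opp g)) :
    Shortenable [f, g, opp f, opp g] p q
      (edist p (unrollPath [f, g, opp f, opp g] q)) := by
  refine cons H hp (fun hlt => ?_) fun hp' => by simpa only [opp_opp] using of_straight H.opp_left.swap hp' (by simpa using hq)
  refine (H.opp_mid.surfaceDist_le_edge hp hq).trans_lt (edist_lt_of_sq ?_)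
  obtain ⟨p1, p2, p3⟩ := (mem_faceSet_iff H).1 hp
  obtain ⟨q1, q2, q3⟩ := (mem_faceSet_iff H.swap.opp_left).1 hq
  rw [co_opp, neg_eq_iff_eq_neg] at q1
  -- The squares cancel in the comparison of the squared distances. What remains is affine in each
  -- point, and these products of slacks make it a linear consequence.
  obtain ⟨_, _, _, _⟩ := mul_nonneg_of_mem_box p2 q2
  obtain ⟨_, _, _, _⟩ := mul_nonneg_of_mem_box p2 q3
  obtain ⟨_, _, _, _⟩ := mul_nonneg_of_mem_box p3 q2
  obtain ⟨_, _, _, _⟩ := mul_nonneg_of_mem_box p3 q3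
  simp only [dist_sq_eq H, unrollPath, co_unroll_left, co_unroll_right, co_unroll_opp_left,
    co_unroll_opp_right, adj_opp_left, adj_opp_right, co_opp, co_unroll_of_adj, H.fg, H.fg.symm,
    H.fh, H.fh.symm, H.gh, H.gh.symm, p1, q1]
  linarith

theorem fghG (H : Frame f g h) (hp : p ∈ faceSet f) (hq : q ∈ faceSet (opp g)) :
    Shortenable [f, g, h, opp g] p q
      (edist p (unrollPath [f, g, h, opp g] q)) := by
  refine cons H hp (fun hlt => ?_) fun hp' => of_straight H.rotate hp' (by simpa using hq)
  refine (H.swap.rotate.opp_right.surfaceDist_le_bend hp hq).trans_lt (edist_lt_of_sq ?_)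
  obtain ⟨p1, p2, p3⟩ := (mem_faceSet_iff H).1 hp
  obtain ⟨q1, q2, q3⟩ := (mem_faceSet_iff H.swap.opp_left).1 hq
  rw [co_opp, neg_eq_iff_eq_neg] at q1
  obtain ⟨_, _, _, _⟩ := mul_nonneg_of_mem_box p2 q2
  obtain ⟨_, _, _, _⟩ := mul_nonneg_of_mem_box p2 q3
  obtain ⟨_, _, _, _⟩ := mul_nonneg_of_mem_box p3 q2
  obtain ⟨_, _, _, _⟩ := mul_nonneg_of_mem_box p3 q3
  simp only [dist_sq_eq H, unrollPath, co_unroll_left, co_unroll_right, co_unroll_opp_left,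
    co_unroll_opp_right, adj_opp_left, adj_opp_right, co_opp, co_unroll_of_adj, H.fg, H.fg.symm,
    H.fh, H.fh.symm, H.gh, H.gh.symm, p1, q1]
  linarith

/-- Here the degenerate case sits at the other end. Skipping `opp f` turns `q` by a right angle
about the vertex common to `g, opp f, h`. This is strictly shorter unless `q` lies on the edge of
`opp f` and `h`, and then the last face can be dropped. -/
theorem fgFh (H : Frame f g h) (hp : p ∈ faceSet f) (hq : q ∈ faceSet h) :
    Shortenable [f, g, opp f, h] p q
      (edist p (unrollPath [f, g, opp f, h] q)) := by
  obtain ⟨q1, ⟨q2, q2'⟩, q3⟩ := (mem_faceSet_iff H.rotate.rotate).1 hq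
  rcases q2.eq_or_lt with hqf | hqf
  · have hqF : q ∈ faceSet (opp f) :=
      (mem_faceSet_iff H.opp_left).2 ⟨by rw [co_opp]; linarith, q3, by linarith, q1.le⟩
    have hu : unroll (opp f) h q = q := unroll_of_co_eq (by rw [co_opp]; linarith) q1
    have := (of_straight H hp hqF).mono (L := [f, g, opp f, h]) ⟨[], [h], rfl⟩
    simpa only [unrollPath, hu] using this
  left
  refine (H.surfaceDist_le_bend hp hq).trans_lt (edist_lt_of_sq ?_)
  obtain ⟨p1, p2, p3⟩ := (mem_faceSet_iff H).1 hp
  obtain ⟨q1, q2, q3⟩ := (mem_faceSet_iff H.rotate.rotate).1 hq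
  obtain ⟨_, _, _, _⟩ := mul_nonneg_of_mem_box p2 q2
  obtain ⟨_, _, _, _⟩ := mul_nonneg_of_mem_box p2 q3
  obtain ⟨_, _, _, _⟩ := mul_nonneg_of_mem_box p3 q2
  obtain ⟨_, _, _, _⟩ := mul_nonneg_of_mem_box p3 q3
  simp only [dist_sq_eq H, unrollPath, co_unroll_left, co_unroll_right, co_unroll_opp_left,
    co_unroll_opp_right, adj_opp_left, adj_opp_right, co_opp, co_unroll_of_adj, H.fg, H.fg.symm,
    H.fh, H.fh.symm, H.gh, H.gh.symm, p1, q1]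
  linarith

theorem fgFGh (H : Frame f g h) (hp : p ∈ faceSet f) (hq : q ∈ faceSet h) :
    Shortenable [f, g, opp f, opp g, h] p q
      (edist p (unrollPath [f, g, opp f, opp g, h] q)) := by
  refine cons H hp (fun hlt => ?_) fun hp' => by simpa only [opp_opp] using fgFh H.opp_left.swap hp' (by simpa using hq)
  refine (H.swap.rotate.surfaceDist_le_edge hp hq).trans_lt (edist_lt_of_sq ?_)
  obtain ⟨p1, p2, p3⟩ := (mem_faceSet_iff H).1 hp
  obtain ⟨q1, q2, q3⟩ := (mem_faceSet_iff H.rotate.rotate).1 hq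
  obtain ⟨_, _, _, _⟩ := mul_nonneg_of_mem_box p2 q2
  obtain ⟨_, _, _, _⟩ := mul_nonneg_of_mem_box p2 q3
  obtain ⟨_, _, _, _⟩ := mul_nonneg_of_mem_box p3 q2
  obtain ⟨_, _, _, _⟩ := mul_nonneg_of_mem_box p3 q3
  simp only [dist_sq_eq H, unrollPath, co_unroll_left, co_unroll_right, co_unroll_opp_left,
    co_unroll_opp_right, adj_opp_left, adj_opp_right, co_opp, co_unroll_of_adj, H.fg, H.fg.symm,
    H.fh, H.fh.symm, H.gh, H.gh.symm, p1, q1]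
  linarith

theorem fgFhG (H : Frame f g h) (hp : p ∈ faceSet f) (hq : q ∈ faceSet (opp g)) :
    Shortenable [f, g, opp f, h, opp g] p q
      (edist p (unrollPath [f, g, opp f, h, opp g] q)) := by
  refine cons H hp (fun hlt => ?_) fun hp' => by simpa only [opp_opp] using of_zigzag H.opp_left.swap hp' (by simpa using hq)
  refine (H.opp_mid.surfaceDist_le_edge hp hq).trans_lt (edist_lt_of_sq ?_)
  obtain ⟨p1, p2, p3⟩ := (mem_faceSet_iff H).1 hp
  obtain ⟨q1, q2, q3⟩ := (mem_faceSet_iff H.swap.opp_left).1 hq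
  rw [co_opp, neg_eq_iff_eq_neg] at q1
  obtain ⟨_, _, _, _⟩ := mul_nonneg_of_mem_box p2 q2
  obtain ⟨_, _, _, _⟩ := mul_nonneg_of_mem_box p2 q3
  obtain ⟨_, _, _, _⟩ := mul_nonneg_of_mem_box p3 q2
  obtain ⟨_, _, _, _⟩ := mul_nonneg_of_mem_box p3 q3
  simp only [dist_sq_eq H, unrollPath, co_unroll_left, co_unroll_right, co_unroll_opp_left,
    co_unroll_opp_right, adj_opp_left, adj_opp_right, co_opp, co_unroll_of_adj, H.fg, H.fg.symm,
    H.fh, H.fh.symm, H.gh, H.gh.symm, p1, q1]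
  linarith

/-- The competitor crosses `h` directly. When `p` is on `g`, what remains has the shape `fgFh` for a
rotated frame; the longer cases below likewise reduce to earlier shapes. -/
theorem fghGF (H : Frame f g h) (hp : p ∈ faceSet f) (hq : q ∈ faceSet (opp f)) :
    Shortenable [f, g, h, opp g, opp f] p q
      (edist p (unrollPath [f, g, h, opp g, opp f] q)) := by
  refine cons H hp (fun hlt => ?_) fun hp' => by simpa only [opp_opp] using fgFh H.opp_left.rotate hp' (by simpa using hq)
  refine (H.swap.rotate.surfaceDist_le_straight hp hq).trans_lt (edist_lt_of_sq ?_)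
  obtain ⟨p1, p2, p3⟩ := (mem_faceSet_iff H).1 hp
  obtain ⟨q1, q2, q3⟩ := (mem_faceSet_iff H.opp_left).1 hq
  rw [co_opp, neg_eq_iff_eq_neg] at q1
  obtain ⟨_, _, _, _⟩ := mul_nonneg_of_mem_box p2 q2
  obtain ⟨_, _, _, _⟩ := mul_nonneg_of_mem_box p2 q3
  obtain ⟨_, _, _, _⟩ := mul_nonneg_of_mem_box p3 q2
  obtain ⟨_, _, _, _⟩ := mul_nonneg_of_mem_box p3 q3
  simp only [dist_sq_eq H, unrollPath, co_unroll_left, co_unroll_right, co_unroll_opp_left,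
    co_unroll_opp_right, adj_opp_left, adj_opp_right, co_opp, co_unroll_of_adj, H.fg, H.fg.symm,
    H.fh, H.fh.symm, H.gh, H.gh.symm, p1, q1]
  linarith

theorem fghGH (H : Frame f g h) (hp : p ∈ faceSet f) (hq : q ∈ faceSet (opp h)) :
    Shortenable [f, g, h, opp g, opp h] p q
      (edist p (unrollPath [f, g, h, opp g, opp h] q)) := by
  refine cons H hp (fun hlt => ?_) fun hp' => fgFG H.rotate hp' (by simpa using hq)
  refine (H.swap.rotate.opp_mid.surfaceDist_le_edge hp hq).trans_lt (edist_lt_of_sq ?_)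
  obtain ⟨p1, p2, p3⟩ := (mem_faceSet_iff H).1 hp
  obtain ⟨q1, q2, q3⟩ := (mem_faceSet_iff H.rotate.rotate.opp_left).1 hq
  rw [co_opp, neg_eq_iff_eq_neg] at q1
  obtain ⟨_, _, _, _⟩ := mul_nonneg_of_mem_box p2 q2
  obtain ⟨_, _, _, _⟩ := mul_nonneg_of_mem_box p2 q3
  obtain ⟨_, _, _, _⟩ := mul_nonneg_of_mem_box p3 q2
  obtain ⟨_, _, _, _⟩ := mul_nonneg_of_mem_box p3 q3
  simp only [dist_sq_eq H, unrollPath, co_unroll_left, co_unroll_right, co_unroll_opp_left,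
    co_unroll_opp_right, adj_opp_left, adj_opp_right, co_opp, co_unroll_of_adj, H.fg, H.fg.symm,
    H.fh, H.fh.symm, H.gh, H.gh.symm, p1, q1]
  linarith

theorem fghFG (H : Frame f g h) (hp : p ∈ faceSet f) (hq : q ∈ faceSet (opp g)) :
    Shortenable [f, g, h, opp f, opp g] p q
      (edist p (unrollPath [f, g, h, opp f, opp g] q)) := by
  refine cons H hp (fun hlt => ?_) fun hp' => by simpa only [opp_opp] using of_zigzag H.opp_left.rotate hp' (by simpa using hq)
  refine (H.swap.rotate.opp_right.surfaceDist_le_bend hp hq).trans_lt (edist_lt_of_sq ?_)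
  obtain ⟨p1, p2, p3⟩ := (mem_faceSet_iff H).1 hp
  obtain ⟨q1, q2, q3⟩ := (mem_faceSet_iff H.swap.opp_left).1 hq
  rw [co_opp, neg_eq_iff_eq_neg] at q1
  obtain ⟨_, _, _, _⟩ := mul_nonneg_of_mem_box p2 q2
  obtain ⟨_, _, _, _⟩ := mul_nonneg_of_mem_box p2 q3
  obtain ⟨_, _, _, _⟩ := mul_nonneg_of_mem_box p3 q2
  obtain ⟨_, _, _, _⟩ := mul_nonneg_of_mem_box p3 q3
  simp only [dist_sq_eq H, unrollPath, co_unroll_left, co_unroll_right, co_unroll_opp_left,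
    co_unroll_opp_right, adj_opp_left, adj_opp_right, co_opp, co_unroll_of_adj, H.fg, H.fg.symm,
    H.fh, H.fh.symm, H.gh, H.gh.symm, p1, q1]
  linarith

theorem fghFH (H : Frame f g h) (hp : p ∈ faceSet f) (hq : q ∈ faceSet (opp h)) :
    Shortenable [f, g, h, opp f, opp h] p q
      (edist p (unrollPath [f, g, h, opp f, opp h] q)) := by
  refine cons H hp (fun hlt => ?_) fun hp' => by simpa only [opp_opp] using fghG H.opp_left.rotate hp' (by simpa using hq)
  refine (H.swap.rotate.opp_mid.surfaceDist_le_edge hp hq).trans_lt (edist_lt_of_sq ?_)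
  obtain ⟨p1, p2, p3⟩ := (mem_faceSet_iff H).1 hp
  obtain ⟨q1, q2, q3⟩ := (mem_faceSet_iff H.rotate.rotate.opp_left).1 hq
  rw [co_opp, neg_eq_iff_eq_neg] at q1
  obtain ⟨_, _, _, _⟩ := mul_nonneg_of_mem_box p2 q2
  obtain ⟨_, _, _, _⟩ := mul_nonneg_of_mem_box p2 q3
  obtain ⟨_, _, _, _⟩ := mul_nonneg_of_mem_box p3 q2
  obtain ⟨_, _, _, _⟩ := mul_nonneg_of_mem_box p3 q3
  simp only [dist_sq_eq H, unrollPath, co_unroll_left, co_unroll_right, co_unroll_opp_left,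
    co_unroll_opp_right, adj_opp_left, adj_opp_right, co_opp, co_unroll_of_adj, H.fg, H.fg.symm,
    H.fh, H.fh.symm, H.gh, H.gh.symm, p1, q1]
  linarith

/-- No degenerate case arises: the last face is laid out as the square centred at `(4, 1)`, at
distance at least `3` from `f`, while two points of the adjacent squares `f, opp h` are at most `√5`
apart. -/
theorem fgFhGH (H : Frame f g h) (hp : p ∈ faceSet f) (hq : q ∈ faceSet (opp h)) :
    Shortenable [f, g, opp f, h, opp g, opp h] p q
      (edist p (unrollPath [f, g, opp f, h, opp g, opp h] q)) := by
  left
  refine (H.swap.rotate.opp_mid.surfaceDist_le_edge hp hq).trans_lt (edist_lt_of_sq ?_)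
  obtain ⟨p1, p2, p3⟩ := (mem_faceSet_iff H).1 hp
  obtain ⟨q1, q2, q3⟩ := (mem_faceSet_iff H.rotate.rotate.opp_left).1 hq
  rw [co_opp, neg_eq_iff_eq_neg] at q1
  obtain ⟨_, _, _, _⟩ := mul_nonneg_of_mem_box p2 q2
  obtain ⟨_, _, _, _⟩ := mul_nonneg_of_mem_box p2 q3
  obtain ⟨_, _, _, _⟩ := mul_nonneg_of_mem_box p3 q2
  obtain ⟨_, _, _, _⟩ := mul_nonneg_of_mem_box p3 q3
  simp only [dist_sq_eq H, unrollPath, co_unroll_left, co_unroll_right, co_unroll_opp_left,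
    co_unroll_opp_right, adj_opp_left, adj_opp_right, co_opp, co_unroll_of_adj, H.fg, H.fg.symm,
    H.fh, H.fh.symm, H.gh, H.gh.symm, p1, q1]
  linarith

theorem fghGFH (H : Frame f g h) (hp : p ∈ faceSet f) (hq : q ∈ faceSet (opp h)) :
    Shortenable [f, g, h, opp g, opp f, opp h] p q
      (edist p (unrollPath [f, g, h, opp g, opp f, opp h] q)) := by
  refine cons H hp (fun hlt => ?_) fun hp' => by simpa only [opp_opp] using fgFhG H.opp_left.rotate hp' (by simpa using hq)
  refine (H.swap.rotate.opp_mid.surfaceDist_le_edge hp hq).trans_lt (edist_lt_of_sq ?_)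
  obtain ⟨p1, p2, p3⟩ := (mem_faceSet_iff H).1 hp
  obtain ⟨q1, q2, q3⟩ := (mem_faceSet_iff H.rotate.rotate.opp_left).1 hq
  rw [co_opp, neg_eq_iff_eq_neg] at q1
  obtain ⟨_, _, _, _⟩ := mul_nonneg_of_mem_box p2 q2
  obtain ⟨_, _, _, _⟩ := mul_nonneg_of_mem_box p2 q3
  obtain ⟨_, _, _, _⟩ := mul_nonneg_of_mem_box p3 q2
  obtain ⟨_, _, _, _⟩ := mul_nonneg_of_mem_box p3 q3
  simp only [dist_sq_eq H, unrollPath, co_unroll_left, co_unroll_right, co_unroll_opp_left,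
    co_unroll_opp_right, adj_opp_left, adj_opp_right, co_opp, co_unroll_of_adj, H.fg, H.fg.symm,
    H.fh, H.fh.symm, H.gh, H.gh.symm, p1, q1]
  linarith

theorem fghGHF (H : Frame f g h) (hp : p ∈ faceSet f) (hq : q ∈ faceSet (opp f)) :
    Shortenable [f, g, h, opp g, opp h, opp f] p q
      (edist p (unrollPath [f, g, h, opp g, opp h, opp f] q)) := by
  refine cons H hp (fun hlt => ?_) fun hp' => by simpa only [opp_opp] using fgFGh H.opp_left.rotate hp' (by simpa using hq)
  refine (H.swap.rotate.surfaceDist_le_straight hp hq).trans_lt (edist_lt_of_sq ?_)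
  obtain ⟨p1, p2, p3⟩ := (mem_faceSet_iff H).1 hp
  obtain ⟨q1, q2, q3⟩ := (mem_faceSet_iff H.opp_left).1 hq
  rw [co_opp, neg_eq_iff_eq_neg] at q1
  obtain ⟨_, _, _, _⟩ := mul_nonneg_of_mem_box p2 q2
  obtain ⟨_, _, _, _⟩ := mul_nonneg_of_mem_box p2 q3
  obtain ⟨_, _, _, _⟩ := mul_nonneg_of_mem_box p3 q2
  obtain ⟨_, _, _, _⟩ := mul_nonneg_of_mem_box p3 q3
  simp only [dist_sq_eq H, unrollPath, co_unroll_left, co_unroll_right, co_unroll_opp_left,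
    co_unroll_opp_right, adj_opp_left, adj_opp_right, co_opp, co_unroll_of_adj, H.fg, H.fg.symm,
    H.fh, H.fh.symm, H.gh, H.gh.symm, p1, q1]
  linarith

theorem fghFGH (H : Frame f g h) (hp : p ∈ faceSet f) (hq : q ∈ faceSet (opp h)) :
    Shortenable [f, g, h, opp f, opp g, opp h] p q
      (edist p (unrollPath [f, g, h, opp f, opp g, opp h] q)) := by
  refine cons H hp (fun hlt => ?_) fun hp' => by simpa only [opp_opp] using fghFG H.opp_left.rotate hp' (by simpa using hq)
  refine (H.swap.rotate.opp_mid.surfaceDist_le_edge hp hq).trans_lt (edist_lt_of_sq ?_)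
  obtain ⟨p1, p2, p3⟩ := (mem_faceSet_iff H).1 hp
  obtain ⟨q1, q2, q3⟩ := (mem_faceSet_iff H.rotate.rotate.opp_left).1 hq
  rw [co_opp, neg_eq_iff_eq_neg] at q1
  obtain ⟨_, _, _, _⟩ := mul_nonneg_of_mem_box p2 q2
  obtain ⟨_, _, _, _⟩ := mul_nonneg_of_mem_box p2 q3
  obtain ⟨_, _, _, _⟩ := mul_nonneg_of_mem_box p3 q2
  obtain ⟨_, _, _, _⟩ := mul_nonneg_of_mem_box p3 q3
  simp only [dist_sq_eq H, unrollPath, co_unroll_left, co_unroll_right, co_unroll_opp_left,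
    co_unroll_opp_right, adj_opp_left, adj_opp_right, co_opp, co_unroll_of_adj, H.fg, H.fg.symm,
    H.fh, H.fh.symm, H.gh, H.gh.symm, p1, q1]
  linarith

theorem fghFHG (H : Frame f g h) (hp : p ∈ faceSet f) (hq : q ∈ faceSet (opp g)) :
    Shortenable [f, g, h, opp f, opp h, opp g] p q
      (edist p (unrollPath [f, g, h, opp f, opp h, opp g] q)) := by
  refine cons H hp (fun hlt => ?_) fun hp' => by simpa only [opp_opp] using fghGF H.opp_left.rotate hp' (by simpa using hq)
  refine (H.opp_mid.surfaceDist_le_edge hp hq).trans_lt (edist_lt_of_sq ?_)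
  obtain ⟨p1, p2, p3⟩ := (mem_faceSet_iff H).1 hp
  obtain ⟨q1, q2, q3⟩ := (mem_faceSet_iff H.swap.opp_left).1 hq
  rw [co_opp, neg_eq_iff_eq_neg] at q1
  obtain ⟨_, _, _, _⟩ := mul_nonneg_of_mem_box p2 q2
  obtain ⟨_, _, _, _⟩ := mul_nonneg_of_mem_box p2 q3
  obtain ⟨_, _, _, _⟩ := mul_nonneg_of_mem_box p3 q2
  obtain ⟨_, _, _, _⟩ := mul_nonneg_of_mem_box p3 q3
  simp only [dist_sq_eq H, unrollPath, co_unroll_left, co_unroll_right, co_unroll_opp_left,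
    co_unroll_opp_right, adj_opp_left, adj_opp_right, co_opp, co_unroll_of_adj, H.fg, H.fg.symm,
    H.fh, H.fh.symm, H.gh, H.gh.symm, p1, q1]
  linarith

end Shortenable

/-! ### From end faces to arbitrary positions, and invalidity -/

theorem IsLandscape.shortenable_ends {f k : Face} {A : List Face} {p q : E3}
    (hL : IsLandscape (f :: A ++ [k])) (hp : p ∈ faceSet f) (hq : q ∈ faceSet k) :
    Shortenable (f :: A ++ [k]) p q (edist p (unrollPath (f :: A ++ [k]) q)) := by
  obtain ⟨h2, hn, hc⟩ := isLandscape_iff.1 hL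
  have hS := shortPath_or_longPath h2 hn hc
  have hf : (f :: A ++ [k]).head? = some f := rfl
  have hk : (f :: A ++ [k]).getLast? = some k := List.getLast?_concat
  generalize f :: A ++ [k] = L at hS hf hk
  rcases hS with hS | hS <;> cases hS <;> rename_i H <;>
    simp only [List.head?_cons, List.getLast?_cons_cons, List.getLast?_singleton,
      Option.some.injEq] at hf hk <;> subst hf hk
  · exact .of_edge H hp hq
  · exact .of_straight H hp hq
  · exact .of_bend H hp hq
  · exact .of_zigzag H hp hq
  · exact .fgFG H hp hq
  · exact .fgFh H hp hq
  · exact .fghG H hp hq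
  · exact .fgFGh H hp hq
  · exact .fgFhG H hp hq
  · exact .fghGF H hp hq
  · exact .fghGH H hp hq
  · exact .fghFG H hp hq
  · exact .fghFH H hp hq
  · exact .fgFhGH H hp hq
  · exact .fghGFH H hp hq
  · exact .fghGHF H hp hq
  · exact .fghFGH H hp hq
  · exact .fghFHG H hp hq

theorem IsLandscape.of_infix {K L : List Face} (hL : IsLandscape L) (h : K <:+: L)
    (h2 : 2 ≤ K.length) : IsLandscape K := by
  obtain ⟨-, hn, T, hT, hc⟩ := hL
  exact ⟨h2, hn.sublist h.sublist, T, hT, hc.infix h⟩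

theorem IsLandscape.shortenable_head {f k : Face} {L : List Face} {p q : E3}
    (hL : IsLandscape (f :: L)) (hk : k ∈ L) (hp : p ∈ faceSet f) (hq : q ∈ faceSet k) :
    Shortenable (f :: L) p q (edist p (develop (f :: L) k q)) := by
  obtain ⟨A, B, rfl⟩ := List.append_of_mem hk
  have hi : f :: A ++ [k] <:+: f :: (A ++ k :: B) := ⟨[], B, by simp⟩
  have hkA : k ∉ f :: A := by
    have := hL.2.1.sublist hi.sublist
    rw [List.nodup_append] at this
    exact fun h => this.2.2 k h k (by simp) rfl
  rw [show f :: (A ++ k :: B) = f :: A ++ k :: B from rfl, develop_eq_unrollPath B q hkA]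
  exact ((hL.of_infix hi (by simp)).shortenable_ends hp hq).mono hi

theorem segment_faceSet_subset {f g : Face} (hfg : faceGraph.Adj f g) {p q : E3}
    (hp : p ∈ faceSet f) (hq : q ∈ faceSet f) : segment ℝ p q ⊆ region [f, g] := by
  obtain ⟨h, H⟩ := exists_frame hfg
  obtain ⟨p1, ⟨p2, p3⟩, p4⟩ := (mem_faceSet_iff H).1 hp
  obtain ⟨q1, ⟨q2, q3⟩, q4⟩ := (mem_faceSet_iff H).1 hq
  exact H.segment_subset_region_edge ⟨p1, ⟨p2, by linarith⟩, p4⟩ ⟨q1, ⟨q2, by linarith⟩, q4⟩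

theorem Frame.segment_unroll_subset {f g h : Face} (H : Frame f g h) {p q : E3}
    (hp : p ∈ faceSet g) (hq : q ∈ faceSet g) :
    segment ℝ (unroll f g p) (unroll f g q) ⊆ region [f, g] := by
  rw [mem_faceSet_iff H.swap] at hp hq
  refine H.segment_subset_region_edge ?_ ?_ <;>
    rw [co_unroll_left H.fg, co_unroll_right H.fg, co_unroll_of_adj H.fh.symm H.gh.symm]
  · exact ⟨hp.1, ⟨by linarith, by linarith⟩, hp.2.2⟩
  · exact ⟨hq.1, ⟨by linarith, by linarith⟩, hq.2.2⟩

/-- Two points at given positions in a landscape are closer on the surface than these positions,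
or are joined by a trail of at most this length in a short sublandscape. -/
theorem IsLandscape.shortenable {L : List Face} (hL : IsLandscape L) {h k : Face} (hh : h ∈ L)
    (hk : k ∈ L) {p q : E3} (hp : p ∈ faceSet h) (hq : q ∈ faceSet k) :
    Shortenable L p q (edist (develop L h p) (develop L k q)) := by
  obtain ⟨h2, hn, hc⟩ := isLandscape_iff.1 hL
  match L with
  | [] => simp at hh
  | [f] => simp at h2
  | f :: g :: L =>
    have hfg : faceGraph.Adj f g := (List.isChain_cons_cons.1 hc).1
    obtain ⟨e, H⟩ := exists_frame hfg
    by_cases hf : h = f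
    · subst hf
      rw [develop_head]
      by_cases hk' : k = h
      · subst hk'
        rw [develop_head]
        refine .inr ⟨[k, g], ⟨[], L, rfl⟩, .edge H, mem_points (by simp) hp,
          mem_points (by simp) hq, ?_⟩
        simpa only [develop_head] using trailLength_le (L := [k, g]) (by simp) hp (by simp) hq
          (by simpa only [develop_head] using segment_faceSet_subset hfg hp hq)
      · exact hL.shortenable_head (List.mem_of_ne_of_mem hk' hk) hp hq
    · have hh' := List.mem_of_ne_of_mem hf hh
      by_cases hk' : k = f
      · subst hk'
        rw [develop_head, edist_comm]
        exact (hL.shortenable_head hh' hq hp).symm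
      · have hk'' := List.mem_of_ne_of_mem hk' hk
        rw [develop_cons_cons_of_ne hf, develop_cons_cons_of_ne hk', edist_unroll hfg]
        -- Neither point is placed on the first face, so it is dropped, unless only one face would
        -- be left, which is not a landscape. In that case both points lie on `k` and the path is
        -- itself a short one.
        match L, hL, hn, hc, hh', hk'' with
        | [], _, _, _, hh', hk'' =>
          rw [List.mem_singleton] at hh' hk''
          subst hh' hk''
          refine .inr ⟨[f, k], List.infix_rfl, .edge H, mem_points (by simp) hp,
            mem_points (by simp) hq, ?_⟩
          simpa only [develop_cons_cons_of_ne hk', develop_head, edist_unroll hfg] using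
            trailLength_le (L := [f, k]) (by simp) hp (by simp) hq
              (by
                simpa only [develop_cons_cons_of_ne hk', develop_head] using
                  H.segment_unroll_subset hp hq)
        | a :: L, hL, _, _, hh', hk'' =>
          have hi : g :: a :: L <:+: f :: g :: a :: L := ⟨[f], [], by simp⟩
          exact ((hL.of_infix hi (by simp)).shortenable hh' hk'' hp hq).mono hi
termination_by L.length

theorem finite_positions (L : List Face) (p : E3) : (positions L p).Finite :=
  (Set.finite_range fun h => develop L h p).subset fun _ ⟨h, _, _, e⟩ => ⟨h, e.symm⟩

/-- A finite trail length is attained. -/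
theorem exists_positions_of_trailLength_ne_top {L : List Face} {p q : E3}
    (h : trailLength L p q ≠ ⊤) : ∃ h ∈ L, p ∈ faceSet h ∧ ∃ k ∈ L, q ∈ faceSet k ∧
      trailLength L p q = edist (develop L h p) (develop L k q) := by
  let S : Set (E3 × E3) :=
    {z | z ∈ positions L p ×ˢ positions L q ∧ segment ℝ z.1 z.2 ⊆ region L}
  have hS : S.Finite :=
    ((finite_positions L p).prod (finite_positions L q)).subset fun _ hz => hz.1
  have hne : S.Nonempty := by
    obtain ⟨x, hx⟩ := iInf_lt_iff.1 h.lt_top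
    obtain ⟨hxp, hx⟩ := iInf_lt_iff.1 hx
    obtain ⟨y, hy⟩ := iInf_lt_iff.1 hx
    obtain ⟨hyq, hy⟩ := iInf_lt_iff.1 hy
    obtain ⟨hs, -⟩ := iInf_lt_iff.1 hy
    exact ⟨(x, y), ⟨hxp, hyq⟩, hs⟩
  obtain ⟨⟨x, y⟩, ⟨⟨hx, hy⟩, hs⟩, hmin⟩ := Set.exists_min_image S (fun z => edist z.1 z.2) hS hne
  have e : trailLength L p q = edist x y := by
    refine le_antisymm ?_ ?_
    · exact iInf₂_le_of_le x hx <| iInf₂_le_of_le y hy <| iInf_le _ hs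
    · exact le_iInf₂ fun x' hx' => le_iInf₂ fun y' hy' => le_iInf fun hs' =>
        hmin (x', y') ⟨⟨hx', hy'⟩, hs'⟩
  obtain ⟨h, hh, hp, rfl⟩ := hx
  obtain ⟨k, hk, hq, rfl⟩ := hy
  exact ⟨h, hh, hp, k, hk, hq, e⟩

theorem IsLandscape.not_isValid {L : List Face} (hL : IsLandscape L) (hnot : ¬ IsAmongFifteen L) :
    ¬ IsValid L := by
  rintro ⟨p, hp, q, hq, hpq, hmin⟩
  have key : ∀ K, K <:+: L → ShortPath K → p ∈ points K → q ∈ points K →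
      trailLength K p q ≤ trailLength L p q → False := by
    intro K hKL hK hpK hqK hle
    -- An infix of full length would be `L` itself, making `L` one of the fifteen; comparing lengths
    -- rules out `L` and its reverse together.
    have hne : K.length ≠ L.length := fun e =>
      hnot (hKL.eq_of_length e ▸ hK.isAmongFifteen)
    refine hmin K hK.isLandscape (fun e => hne (by rw [e])) (fun e => hne (by rw [e]; simp))
      hpK hqK (le_antisymm ?_ hle) (.inl hKL)
    rw [hpq]
    exact surfaceDist_le_trailLength hK.isLandscape p q
  -- Without any trail in `L`, arbitrary positions of the two points will do, since the comparison
  -- never requires the segment to lie in the layout.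
  by_cases htop : trailLength L p q = ⊤
  · simp only [points, Set.mem_iUnion] at hp hq
    obtain ⟨h, hh, hp⟩ := hp
    obtain ⟨k, hk, hq⟩ := hq
    rcases hL.shortenable hh hk hp hq with h1 | ⟨K, h1, h2, h3, h4, h5⟩
    · rw [← hpq, htop] at h1
      exact not_top_lt h1
    · exact key K h1 h2 h3 h4 (htop ▸ le_top)
  · obtain ⟨h, hh, hp, k, hk, hq, e⟩ := exists_positions_of_trailLength_ne_top htop
    rcases hL.shortenable hh hk hp hq with h1 | ⟨K, h1, h2, h3, h4, h5⟩
    · rw [← e, hpq] at h1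
      exact lt_irrefl _ h1
    · exact key K h1 h2 h3 h4 (e ▸ h5)

end Cube

theorem mainTheorem3 :
    (∀ L : List Face, Cube.IsLandscape L → ¬ Cube.IsAmongFifteen L → ¬ Cube.IsValid L) ∧
    (∀ n : Equiv.Perm Face, Cube.IsLabelling n → ∀ i : Fin 5,
      Cube.IsLandscape (Cube.starred n i) ∧ ¬ Cube.IsValid (Cube.starred n i)) ∧
    (∀ L : List Face, Cube.IsLandscape L → ¬ Cube.IsAmongFifteen L →
      ∃ n : Equiv.Perm Face, Cube.IsLabelling n ∧ ∃ i : Fin 5,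
        Cube.IsSublandscape (Cube.starred n i) L) := by
  refine ⟨fun L hL h => hL.not_isValid h, fun n hn i => ⟨Cube.starred_isLandscape hn i,
    (Cube.starred_isLandscape hn i).not_isValid (Cube.starred_not_isAmongFifteen hn i)⟩,
    fun L hL h => ?_⟩
  obtain ⟨h2, hn, hc⟩ := Cube.isLandscape_iff.1 hL
  rcases Cube.shortPath_or_longPath h2 hn hc with hS | hS
  exacts [(h hS.isAmongFifteen).elim, hS.containsStarred]
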